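/- Let $d\ge 0$ and let $V_d=\{y\in\mathbb R^{d+1}:\sum_i y_i=0\}$, with dual space $W_d=\mathbb R^{d+1}/\mathbb R(1,\dots,1)$. The nested Braid fan $\mathrm{Br}_d^2$ in $W_d$ consists of the cones $\sigma(\pi,\tau)$, for $(\pi,\tau)\in\mathfrak S_{d+1}\times\mathfrak S_d$, together with all of their faces, where $\sigma(\pi,\tau)$ is the set of (classes of) $x$ with $x_{\pi^{-1}(1)}\le\dots\le x_{\pi^{-1}(d+1)}$ and $\Delta_{\tau^{-1}(1)}\le\dots\le\Delta_{\tau^{-1}(d)}$, with $\Delta_i=x_{\pi^{-1}(i+1)}-x_{\pi^{-1}(i)}$. Let $\mathcal O_{d+1}$ be the poset of ordered set partitions of $[d+1]$ into nonempty blocks, ordered by refinement (merging consecutive blocks goes up), with maximum $\hat 1=[d+1]$; an ordered set partition with $k$ blocks has rank $d+1-k$. Let $\overline{\mathcal O_{d+1}}=\mathcal O_{d+1}\setminus\{\hat 1\}$, and for $T=S_1|\cdots|S_k$ put $e_T=\sum_i i\,e_{S_i}\in W_d$, where $e_S=\sum_{j\in S}e_j$. For a full-dimensional polytope $P_0=\{x:\langle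 a_i,x\rangle\le b_{0,i},\ 1\le i\le m\}$, in which the inequalities define the distinct facets of $P_0$, the deformation cone $\mathrm{Def}(P_0)\subset\mathbb R^m$ is the set of all $b$ such that $Q=\{x:\langle a_i,x\rangle\le b_i\ \forall i\}$ is a polytope and, for every vertex $v$ of $P_0$, the hyperplanes $\langle a_i,x\rangle=b_i$ over all facets $i$ containing $v$ intersect in exactly one point, which is a vertex of $Q$. For a fan $\Sigma$ that is the normal fan of a polytope, $\mathrm{Def}(\Sigma)$ is the common deformation cone of all polytopes with normal fan $\Sigma$. For $\Sigma=\mathrm{Br}_d^2$ the facet normals $a_i$ are taken to be the vectors $e_T$, $T\in\overline{\mathcal O_{d+1}}$. For $M,N>0$ and $(\pi,\tau)\in\mathfrak S_{d+1}\times\mathfrak S_d$ let $v_{\pi,\tau}=M\sum_{i=1}^{d+1} i\,e_{\pi^{-1}(i)}+N\sum_{i=1}^{d} i\,\bigl(e_{\pi^{-1}(\tau^{-1}(i)+1)}-e_{\pi^{-1}(\tau^{-1}(i))}\bigr)$. Call $(M,N)$ appropriate if for all $(\pi,\tau)$ the coefficient of $e_{\pi^{-1}(i)}$ in $v_{\pi,\tau}$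 increases strictly with $i$. The regular nested permutohedron $\Pi_d^2(M,N)$ is then the convex hull of all $v_{\pi,\tau}$; its centralized version is its translate by a multiple of $(1,\dots,1)$ that lies in $V_d$. **Theorem.** $\mathrm{Br}_d^2$ is the normal fan of a polytope, and the deformation cone of $\mathrm{Br}_d^2$, as well as that of the centralized regular nested permutohedron $\Pi_d^2(M,N)$ for every appropriate $(M,N)$, is the set of all $b\in\mathbb R^{\overline{\mathcal O_{d+1}}}$ that satisfy, with the convention $b_{\hat 1}=b_{[d+1]}=0$, the following two conditions. 1. (Local submodularity) For every $\pi\in\mathfrak S_{d+1}$ and all $S,T$ in the interval $[T(\pi),\hat 1]$ of $\mathcal O_{d+1}$, where $T(\pi)=\pi^{-1}(1)|\cdots|\pi^{-1}(d+1)$, one has $b_{S\vee T}+b_{S\wedge T}\le b_S+b_T$, with join and meet taken in the interval. Equivalently, all diamond inequalities $b_C+b_A\le b_B+b_{B'}$ hold, where $A$ is covered by $B\ne B'$ and both are covered by $C$. 2. (Ren condition) For every element $T=s_1|\cdots|s_{i-1}|s_is_i'|s_{i+1}|\cdots|s_d$ of rank $1$ of $\mathcal O_{d+1}$, let $T_0,T_0'$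 be the two rank-$0$ elements covered by $T$, and let $S=s_1\cdots s_{i-1}|s_is_i'|s_{i+1}\cdots s_d$ (empty blocks omitted) be the maximum element above $T$ that still has $\{s_i,s_i'\}$ as a block. Then $2b_T+b_S\le b_{T_0}+b_{T_0'}$. -/

import Mathlib

namespace NestedBraid

/-! ## Polytopes, normal fans and deformation cones

`V` is a real vector space; `W` is its dual `Module.Dual ℝ V`. -/

section Polytopes

variable {V : Type*} [NormedAddCommGroup V] [NormedSpace ℝ V]

/-- A polytope is a bounded solution set of finitely many linear inequalities
`⟨w, x⟩ ≤ c`. -/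
def IsPolytope (P : Set V) : Prop :=
  Bornology.IsBounded P ∧
    ∃ s : Finset (Module.Dual ℝ V × ℝ), P = {x | ∀ c ∈ s, c.1 x ≤ c.2}

/-- A (nonempty) face of a set `C`: the set of the points of `C` at which some linear functional
attains its maximum over `C`.  (The functional `0` gives `C` itself.)  It is used for polytopes
in `V` and for polyhedral cones in the dual of `V`. -/
def IsFace {E : Type*} [AddCommGroup E] [Module ℝ E] (C F : Set E) : Prop :=
  F.Nonempty ∧ ∃ l : Module.Dual ℝ E, F = {x ∈ C | ∀ y ∈ C, l y ≤ l x}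

/-- A vertex is a face consisting of one point. -/
def IsVertex (P : Set V) (v : V) : Prop := IsFace P {v}

/-- A facet is a face of codimension one in `V`  (only used for full-dimensional `P`). -/
def IsFacet (P F : Set V) : Prop :=
  IsFace P F ∧ Module.finrank ℝ (vectorSpan ℝ F) + 1 = Module.finrank ℝ V

/-- The normal cone of `P` at its face `F`: the functionals that attain their maximum over `P`
at every point of `F`. -/
def normalCone (P F : Set V) : Set (Module.Dual ℝ V) :=
  {w | ∀ x ∈ F, ∀ y ∈ P, w y ≤ w x}

/-- The normal fan of `P`: the collection of the normal cones at all faces of `P`. -/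
def normalFan (P : Set V) : Set (Set (Module.Dual ℝ V)) :=
  {C | ∃ F, IsFace P F ∧ C = normalCone P F}

variable {ι : Type*}

/-- `P₀` is a full-dimensional polytope, defined by the system `⟨a i, x⟩ ≤ b₀ i` in which each
inequality defines a facet, different inequalities defining different facets. -/
structure IsFacetDescription (P₀ : Set V) (a : ι → Module.Dual ℝ V) (b₀ : ι → ℝ) : Prop where
  polytope : IsPolytope P₀
  fullDim : affineSpan ℝ P₀ = ⊤
  eq_setOf : P₀ = {x | ∀ i, a i x ≤ b₀ i}
  facet : ∀ i, IsFacet P₀ {x ∈ P₀ | a i x = b₀ i}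
  injective : Function.Injective fun i => {x ∈ P₀ | a i x = b₀ i}

/-- `Q` is a deformation of the polytope `P₀ = {x | ∀ i, ⟨a i, x⟩ ≤ b₀ i}`, with deforming vector
`b`: the polytope `Q` is defined by `⟨a i, x⟩ ≤ b i`, and for every vertex `v` of `P₀` the
hyperplanes `⟨a i, x⟩ = b i`, for the facets `i` of `P₀` on which `v` lies, intersect in a single
point, which is a vertex of `Q`. -/
def IsDeformingVector (P₀ : Set V) (a : ι → Module.Dual ℝ V) (b₀ : ι → ℝ)
    (Q : Set V) (b : ι → ℝ) : Prop :=
  IsPolytope Q ∧ Q = {x | ∀ i, a i x ≤ b i} ∧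
    ∀ v, IsVertex P₀ v →
      ∃ u, IsVertex Q u ∧ {x | ∀ i, a i v = b₀ i → a i x = b i} = {u}

/-- The deformation cone of the full-dimensional polytope `P₀` whose facets have the outer normal
vectors `a i`: the set of all deforming vectors. (If the `a i` are not the facet normals of `P₀`,
one for each facet, then this set is empty.) -/
def deformationCone (P₀ : Set V) (a : ι → Module.Dual ℝ V) : Set (ι → ℝ) :=
  {b | ∃ b₀ Q, IsFacetDescription P₀ a b₀ ∧ IsDeformingVector P₀ a b₀ Q b}

/-- `D` is the deformation cone of the fan `𝓕` whose rays are generated by the vectors `a i`: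
the fan is projective, i.e. the normal fan of some polytope, and all the polytopes with
normal fan `𝓕` have the deformation cone `D`. -/
def IsDeformationConeOfFan (𝓕 : Set (Set (Module.Dual ℝ V))) (a : ι → Module.Dual ℝ V)
    (D : Set (ι → ℝ)) : Prop :=
  (∃ P₀, IsPolytope P₀ ∧ normalFan P₀ = 𝓕) ∧
    ∀ P₀, IsPolytope P₀ → normalFan P₀ = 𝓕 → deformationCone P₀ a = D

end Polytopes

/-! ## Ordered set partitions -/

/-- An ordered set partition `S₀ | S₁ | ⋯ | Sₖ` of `Fin n` into nonempty blocks, given by the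
function `label` that sends each element to the position (counted from `0`) of its block.
That no block is empty means that the range of `label` is an initial segment of `ℕ`. -/
@[ext]
structure OrderedSetPartition (n : ℕ) where
  label : Fin n → ℕ
  isLowerSet_range : IsLowerSet (Set.range label)

namespace OrderedSetPartition

variable {n : ℕ}

/-- The block in position `j` (counted from `0`). -/
def block (T : OrderedSetPartition n) (j : ℕ) : Finset (Fin n) :=
  Finset.univ.filter fun i => T.label i = j

/-- The number of blocks. -/
def numBlocks (T : OrderedSetPartition n) : ℕ := (Finset.univ.image T.label).card

/-- The rank of `T` in the poset of ordered set partitions: partitions into singletons have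
rank `0`, and the rank grows by one whenever two consecutive blocks are merged. -/
def rank (T : OrderedSetPartition n) : ℕ := n - T.numBlocks

theorem label_le_label {S T : OrderedSetPartition n}
    (h : ∀ i j, T.label i ≤ T.label j → S.label i ≤ S.label j) (m : ℕ) :
    ∀ i, S.label i = m → m ≤ T.label i := by
  induction m with
  | zero => intro i _; exact Nat.zero_le _
  | succ m ih =>
    intro i hi
    obtain ⟨j, hj⟩ := S.isLowerSet_range (show m ≤ S.label i by omega) ⟨i, rfl⟩
    have h1 := ih j hj
    have h2 : ¬ T.label i ≤ T.label j := fun hc => by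
      have := h i j hc
      omega
    omega

/-- The refinement order: `S ≤ T` if `S` refines `T`, i.e. every block of `T` is a union of
consecutive blocks of `S`, in the same order. -/
instance : PartialOrder (OrderedSetPartition n) where
  le S T := ∀ i j, S.label i ≤ S.label j → T.label i ≤ T.label j
  le_refl _ _ _ h := h
  le_trans _ _ _ h₁ h₂ i j h := h₂ i j (h₁ i j h)
  le_antisymm S T h₁ h₂ := by
    ext i
    exact le_antisymm (label_le_label h₂ _ i rfl) (label_le_label h₁ _ i rfl)

/-- The maximum of the poset is the partition with at most one block. -/
instance : OrderTop (OrderedSetPartition n) where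
  top := ⟨fun _ => 0, by
    rintro a b hba ⟨i, hi⟩
    exact ⟨i, by simp only at hi ⊢; omega⟩⟩
  le_top _ _ _ _ := le_refl 0

/-- The partition `π⁻¹(0) | π⁻¹(1) | ⋯ | π⁻¹(n-1)` into singletons. -/
def ofPerm (π : Equiv.Perm (Fin n)) : OrderedSetPartition n where
  label i := (π i : ℕ)
  isLowerSet_range := by
    rintro a b hba ⟨i, rfl⟩
    exact ⟨π.symm ⟨b, lt_of_le_of_lt hba (π i).isLt⟩, by simp⟩

end OrderedSetPartition

open OrderedSetPartition

/-- The non-maximal ordered set partitions of `[d+1]`. -/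
abbrev ProperOSP (d : ℕ) : Type := {T : OrderedSetPartition (d + 1) // T ≠ ⊤}

/-! ## The nested Braid fan -/

/-- The hyperplane `V_d = {y ∈ ℝ^{d+1} : y₁ + ⋯ + y_{d+1} = 0}`. -/
def hyperplane (d : ℕ) : Submodule ℝ (Fin (d + 1) → ℝ) where
  carrier := {y | ∑ i, y i = 0}
  add_mem' {x y} hx hy := by
    simp only [Set.mem_ofPred_eq] at hx hy ⊢
    simp [Finset.sum_add_distrib, hx, hy]
  zero_mem' := by simp
  smul_mem' c x hx := by
    simp only [Set.mem_ofPred_eq] at hx ⊢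
    simp [← Finset.mul_sum, hx]

/-- The map that sends `x ∈ ℝ^{d+1}` to the functional `y ↦ ∑ xᵢ yᵢ` on `V_d`.  It is onto, with
kernel `ℝ·(1,…,1)`, and so it is the quotient map `ℝ^{d+1} → ℝ^{d+1}/ℝ·(1,…,1) = W_d`, where
`W_d` is identified with the dual of `V_d`. -/
def toDual (d : ℕ) : (Fin (d + 1) → ℝ) →ₗ[ℝ] Module.Dual ℝ (hyperplane d) :=
  LinearMap.mk₂ ℝ (fun x (y : hyperplane d) => ∑ i, x i * (y : Fin (d + 1) → ℝ) i)
    (fun x x' y => by simp [add_mul, Finset.sum_add_distrib])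
    (fun c x y => by simp [Finset.mul_sum, mul_assoc])
    (fun x y y' => by simp [mul_add, Finset.sum_add_distrib])
    (fun c x y => by simp [Finset.mul_sum, mul_left_comm])

/-- The closed cone `σ(π, τ)` in `W_d`: the classes of the `x ∈ ℝ^{d+1}` with
`x_{π⁻¹(1)} ≤ ⋯ ≤ x_{π⁻¹(d+1)}` whose first differences
`Δᵢ = x_{π⁻¹(i+1)} - x_{π⁻¹(i)}` satisfy `Δ_{τ⁻¹(1)} ≤ ⋯ ≤ Δ_{τ⁻¹(d)}`. -/
def nestedCone (d : ℕ) (π : Equiv.Perm (Fin (d + 1))) (τ : Equiv.Perm (Fin d)) :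
    Set (Module.Dual ℝ (hyperplane d)) :=
  toDual d '' {x | Monotone (fun i => x (π.symm i)) ∧
    Monotone (fun i : Fin d => x (π.symm (τ.symm i).succ) - x (π.symm (τ.symm i).castSucc))}

/-- The nested Braid fan `Br_d^2`: the cones `σ(π, τ)` together with all of their faces. -/
def nestedBraidFan (d : ℕ) : Set (Set (Module.Dual ℝ (hyperplane d))) :=
  {F | ∃ π τ, IsFace (nestedCone d π τ) F}

/-- The vector `e_T = ∑ᵢ i · e_{Sᵢ}` (with `i` counted from `1`) for `T = S₁ | ⋯ | Sₖ`, as an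
element of `W_d`. -/
def rayVector (d : ℕ) (T : ProperOSP d) : Module.Dual ℝ (hyperplane d) :=
  toDual d fun i => (T.1.label i : ℝ) + 1

/-! ## Nested permutohedra -/

/-- The point `M ∑ᵢ αᵢ e_{π⁻¹(i)} + N ∑ᵢ βᵢ f^π_{τ⁻¹(i)}`, where
`f^π_i = e_{π⁻¹(i+1)} - e_{π⁻¹(i)}`. -/
noncomputable def nestedPoint {d : ℕ} (α : Fin (d + 1) → ℝ) (β : Fin d → ℝ) (M N : ℝ)
    (π : Equiv.Perm (Fin (d + 1))) (τ : Equiv.Perm (Fin d)) : Fin (d + 1) → ℝ :=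
  M • ∑ i, α i • (Pi.single (π.symm i) 1 : Fin (d + 1) → ℝ) +
    N • ∑ i, β i • ((Pi.single (π.symm (τ.symm i).succ) 1 : Fin (d + 1) → ℝ) -
      Pi.single (π.symm (τ.symm i).castSucc) 1)

/-- `(M, N)` is an appropriate choice for `(α, β)`: `M, N > 0` and, for all `(π, τ)`, the coefficient
of `e_{π⁻¹(i)}` in the point above increases strictly with `i`. -/
def IsAppropriate {d : ℕ} (α : Fin (d + 1) → ℝ) (β : Fin d → ℝ) (M N : ℝ) : Prop :=
  0 < M ∧ 0 < N ∧ ∀ π τ, StrictMono fun i => nestedPoint α β M N π τ (π.symm i)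

/-- The nested permutohedron `Perm(α, β; M, N)`. -/
noncomputable def nestedPermutohedron {d : ℕ} (α : Fin (d + 1) → ℝ) (β : Fin d → ℝ) (M N : ℝ) :
    Set (Fin (d + 1) → ℝ) :=
  convexHull ℝ {v | ∃ π τ, v = nestedPoint α β M N π τ}

/-- The centralized version in `V_d` of a polytope that lies in an affine hyperplane `∑ xᵢ = c`:
its translate by `-(c / (d + 1)) (1, …, 1)`. -/
def centralize {d : ℕ} (P : Set (Fin (d + 1) → ℝ)) : Set (hyperplane d) :=
  {y | ∃ x ∈ P, (y : Fin (d + 1) → ℝ) = fun i => x i - (∑ j, x j) / (d + 1)}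

/-- The sequence `(1, 2, …, n)`. -/
def regularSeq (n : ℕ) : Fin n → ℝ := fun i => (i : ℝ) + 1

/-! ## The conditions on `b` -/

/-- The extension of `b` to all ordered set partitions by `b_{[d+1]} = 0`. -/
noncomputable def extend {d : ℕ} (b : ProperOSP d → ℝ) (T : OrderedSetPartition (d + 1)) : ℝ :=
  open Classical in if h : T = ⊤ then 0 else b ⟨T, h⟩

/-- Local submodularity: for every maximal interval `[T(π), 1̂]` and all `S, T` in it,
`b_{S ∨ T} + b_{S ∧ T} ≤ b_S + b_T`, where `∨` and `∧` are the join and the meet in the interval. -/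
def LocallySubmodular {d : ℕ} (b : ProperOSP d → ℝ) : Prop :=
  ∀ π : Equiv.Perm (Fin (d + 1)), ∀ S T J K : Set.Ici (ofPerm π),
    IsLUB {S, T} J → IsGLB {S, T} K →
      extend b J + extend b K ≤ extend b S + extend b T

/-- All the diamond submodular inequalities: if `A` is covered by two elements `B ≠ B'` that are
both covered by `C`, then `b_C + b_A ≤ b_B + b_{B'}`. -/
def DiamondSubmodular {d : ℕ} (b : ProperOSP d → ℝ) : Prop :=
  ∀ A B B' C : OrderedSetPartition (d + 1), A ⋖ B → A ⋖ B' → B ⋖ C → B' ⋖ C → B ≠ B' →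
    extend b C + extend b A ≤ extend b B + extend b B'

/-- The ren condition.  Let `T` be of rank one, with the two-element block `{s, s'}`, let `T₀` and
`T₀'` be the two elements covered by `T`, and let `S` be the maximum element above `T` that still
has `{s, s'}` as a block. Then `2 b_T + b_S ≤ b_{T₀} + b_{T₀'}`. -/
def RenCondition {d : ℕ} (b : ProperOSP d → ℝ) : Prop :=
  ∀ T T₀ T₀' S : OrderedSetPartition (d + 1), ∀ s s' : Fin (d + 1), T.rank = 1 →
    s ≠ s' → T.label s = T.label s' → T₀ ⋖ T → T₀' ⋖ T → T₀ ≠ T₀' →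
      IsGreatest {U | T ≤ U ∧ ∃ j, U.block j = {s, s'}} S →
        2 * extend b T + extend b S ≤ extend b T₀ + extend b T₀'

end NestedBraid

open NestedBraid

/-!
The conditions on `b` are read as convexity conditions on a piecewise linear function on `W_d`.

A maximal cone `σ(π, τ)` is generated by the rays `e_T` for a flag of ordered set partitions `T`
above `T(π)`; in terms of sets of bars (`cut`), this is a maximal flag of subsets of `Fin d`
(`upper τ j`).  The generators form a basis of the dual space with an explicit dual basis
(`nestedFan`), so every `b` prescribes one point for each maximal cone.  For any polytope whose
normal cones at the vertices are the cones of a complete simplicial fan, the deformation cone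
consists of those `b` for which each of these points satisfies all the inequalities
(`CompleteSimplicialFan.nefCone`, `IsVertexSystem.deformationCone_eq`).

It remains to identify this cone (`nefCone_nestedFan`).  Its inequalities imply the two conditions
by means of the relations `e_{A ∪ B} + e_{A ∩ B} = e_A + e_B` and `2 e_T + e_S = e_{T₀} + e_{T₀'}`.
Conversely, fix a functional `x`.  Within a chamber of the braid arrangement, local submodularity
makes the linear pieces of `b` the vertices of a base polytope, and by the greedy algorithm the
order `τ` that sorts the first differences of `x` gives the largest value at `x`
(`linearPiece_le_of_monotone_gap`).  If the smallest difference is then negative, crossing the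
corresponding wall of the chamber does not decrease the value at `x`: this is the ren condition,
combined with the greedy bound for the partition `S`, which need not lie in the flag
(`linearPiece_le_linearPiece_swapAt`).  Such steps lead to the cone that contains `x`, as in the
simplex algorithm.

That the fan is the normal fan of a polytope is shown by the nested permutohedra: by the
rearrangement inequality, applied once to the coordinates and once to their first differences, a
functional is maximal exactly at those points `v_{π, τ}` whose cone contains it
(`sum_mul_nestedPoint_le`).
-/

namespace NestedBraid

/-! ### Complete simplicial fans and their deformation cones -/

/-- A set on which every linear functional is bounded above is bounded. -/
theorem isBounded_of_forall_dual_le {V : Type*} [NormedAddCommGroup V] [NormedSpace ℝ V]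
    [FiniteDimensional ℝ V] {S : Set V}
    (h : ∀ w : Module.Dual ℝ V, ∃ c, ∀ x ∈ S, w x ≤ c) : Bornology.IsBounded S := by
  let e := (Module.finBasis ℝ V).equivFunL
  have h1 : Bornology.IsBounded (e '' S) := by
    rw [← Bornology.forall_isBounded_image_eval_iff]
    intro i
    obtain ⟨c, hc⟩ := h ((Module.finBasis ℝ V).coord i)
    obtain ⟨c', hc'⟩ := h (-(Module.finBasis ℝ V).coord i)
    refine (Metric.isBounded_Icc (-c') c).subset ?_
    rintro _ ⟨_, ⟨x, hx, rfl⟩, rfl⟩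
    have h1 := hc x hx
    have h2 := hc' x hx
    simp only [LinearMap.neg_apply] at h2
    exact ⟨by change -c' ≤ (Module.finBasis ℝ V).coord i x; linarith, h1⟩
  have h2 := e.symm.lipschitz.isBounded_image h1
  have h3 : e.symm '' (e '' S) = S := by
    ext x; simp
  rwa [h3] at h2

/-- A complete simplicial fan in the dual of `V`, given by its rays `ray i` and its maximal cones,
which are indexed by `K`.  The cone `σ` is generated by the basis `ray (gen σ j)` of the dual of `V`,
and `coord σ` is the dual basis in `V`.  That two maximal cones meet in a common face is not
required: it follows once the cones are the normal cones at the vertices of a polytope. -/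
structure CompleteSimplicialFan (V ι K κ : Type*) [AddCommGroup V] [Module ℝ V] [Fintype κ]
    [DecidableEq κ] where
  ray : ι → Module.Dual ℝ V
  gen : K → κ → ι
  coord : K → κ → V
  ray_coord : ∀ σ j k, ray (gen σ j) (coord σ k) = if j = k then 1 else 0
  expand : ∀ σ (w : Module.Dual ℝ V), w = ∑ j, w (coord σ j) • ray (gen σ j)
  complete : ∀ w : Module.Dual ℝ V, ∃ σ, ∀ j, 0 ≤ w (coord σ j)
  exists_gen : ∀ i, ∃ σ j, gen σ j = i
  ray_injective : ∀ i i' (c : ℝ), 0 < c → ray i' = c • ray i → i' = i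

namespace CompleteSimplicialFan

section Algebra

variable {V ι K κ : Type*} [AddCommGroup V] [Module ℝ V] [Fintype κ] [DecidableEq κ]
  (Φ : CompleteSimplicialFan V ι K κ)

/-- The maximal cone `σ`. -/
def cone (σ : K) : Set (Module.Dual ℝ V) := {w | ∀ j, 0 ≤ w (Φ.coord σ j)}

/-- The point at which the generators of the cone `σ` take the values prescribed by `b`. -/
def point (b : ι → ℝ) (σ : K) : V := ∑ j, b (Φ.gen σ j) • Φ.coord σ j

theorem ray_gen_point (b : ι → ℝ) (σ : K) (j : κ) :
    Φ.ray (Φ.gen σ j) (Φ.point b σ) = b (Φ.gen σ j) := by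
  simp [point, Φ.ray_coord]

theorem apply_point (b : ι → ℝ) (σ : K) (w : Module.Dual ℝ V) :
    w (Φ.point b σ) = ∑ j, w (Φ.coord σ j) * b (Φ.gen σ j) := by
  simp [point, mul_comm]

theorem apply_eq (σ : K) (w : Module.Dual ℝ V) (x : V) :
    w x = ∑ j, w (Φ.coord σ j) * Φ.ray (Φ.gen σ j) x := by
  conv_lhs => rw [Φ.expand σ w]
  simp

theorem eq_of_ray_gen_eq {σ : K} {x y : V}
    (h : ∀ j, Φ.ray (Φ.gen σ j) x = Φ.ray (Φ.gen σ j) y) : x = y := by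
  rw [← sub_eq_zero, ← Module.forall_dual_apply_eq_zero_iff ℝ]
  intro w
  rw [map_sub, Φ.apply_eq σ w x, Φ.apply_eq σ w y]
  simp [h]

theorem ray_gen_mem (σ : K) (j : κ) : Φ.ray (Φ.gen σ j) ∈ Φ.cone σ := by
  intro k
  rw [Φ.ray_coord]
  split_ifs <;> simp

theorem zero_mem_cone (σ : K) : 0 ∈ Φ.cone σ := fun _ => le_rfl

theorem sum_ray_gen_mem (σ : K) (J : Finset κ) : ∑ j ∈ J, Φ.ray (Φ.gen σ j) ∈ Φ.cone σ := by
  intro k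
  rw [LinearMap.sum_apply]
  exact Finset.sum_nonneg fun j _ => Φ.ray_gen_mem σ j k

/-- The vectors `b` for which every `point b σ` satisfies all the inequalities `ray i ≤ b i`. -/
def nefCone : Set (ι → ℝ) := {b | ∀ σ i, Φ.ray i (Φ.point b σ) ≤ b i}

variable {Φ}

/-- For `b` in the nef cone, the piecewise linear function with the values `b i` at the rays is the
support function of the points `point b σ`. -/
theorem apply_point_le_of_mem_nefCone {b : ι → ℝ} (hb : b ∈ Φ.nefCone) {σ' : K}
    {w : Module.Dual ℝ V} (hw : w ∈ Φ.cone σ') (σ : K) :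
    w (Φ.point b σ) ≤ w (Φ.point b σ') := by
  rw [Φ.apply_eq σ' w, Φ.apply_point b σ']
  exact Finset.sum_le_sum fun j _ => mul_le_mul_of_nonneg_left (hb σ _) (hw j)

theorem ray_point_eq_of_mem_nefCone {b : ι → ℝ} (hb : b ∈ Φ.nefCone) {σ : K} {i : ι}
    (hi : Φ.ray i ∈ Φ.cone σ) : Φ.ray i (Φ.point b σ) = b i := by
  obtain ⟨σ', j, rfl⟩ := Φ.exists_gen i
  refine le_antisymm (hb _ _) ?_
  rw [← Φ.ray_gen_point b σ' j]
  exact apply_point_le_of_mem_nefCone hb hi σ'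

theorem apply_le_of_forall_ray_le {σ : K} {w : Module.Dual ℝ V} (hw : w ∈ Φ.cone σ) {x y : V}
    (h : ∀ j, Φ.ray (Φ.gen σ j) x ≤ Φ.ray (Φ.gen σ j) y) : w x ≤ w y := by
  rw [Φ.apply_eq σ w, Φ.apply_eq σ w y]
  exact Finset.sum_le_sum fun j _ => mul_le_mul_of_nonneg_left (h j) (hw j)

/-- If the sum of some generators of `σ` is at least as large at `x` as at `y`, while each single
generator is at most as large, then all these generators agree at `x` and `y`. -/
theorem ray_gen_eq_of_sum_le {σ : K} {J : Finset κ} {x y : V}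
    (h : ∀ j ∈ J, Φ.ray (Φ.gen σ j) x ≤ Φ.ray (Φ.gen σ j) y)
    (hs : (∑ j ∈ J, Φ.ray (Φ.gen σ j)) y ≤ (∑ j ∈ J, Φ.ray (Φ.gen σ j)) x) :
    ∀ j ∈ J, Φ.ray (Φ.gen σ j) x = Φ.ray (Φ.gen σ j) y := by
  simp only [LinearMap.sum_apply] at hs
  exact (Finset.sum_eq_sum_iff_of_le h).1 (le_antisymm (Finset.sum_le_sum h) hs)

end Algebra

variable {V ι K κ : Type*} [NormedAddCommGroup V] [NormedSpace ℝ V] [Fintype κ]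
  [DecidableEq κ] {Φ : CompleteSimplicialFan V ι K κ}

variable (Φ) in
/-- The points `v σ` are the vertices of `P`, and the normal cone at `v σ` is the cone `σ`. -/
structure IsVertexSystem (P : Set V) (v : K → V) : Prop where
  mem : ∀ σ, v σ ∈ P
  mem_cone_iff : ∀ σ w, w ∈ Φ.cone σ ↔ ∀ y ∈ P, w y ≤ w (v σ)

/-- If the normal fan of `P` consists of the cones of `Φ` and of their faces, then each maximal cone
is the normal cone at a vertex of `P`, since it spans the dual of `V`. -/
theorem exists_isVertexSystem {P : Set V}
    (h : normalFan P = {F | ∃ σ, IsFace (Φ.cone σ) F}) : ∃ v, Φ.IsVertexSystem P v := by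
  have key : ∀ σ, ∃ x ∈ P, ∀ w, w ∈ Φ.cone σ ↔ ∀ y ∈ P, w y ≤ w x := by
    intro σ
    have h1 : Φ.cone σ ∈ normalFan P := by
      rw [h]
      exact ⟨σ, ⟨0, Φ.zero_mem_cone σ⟩, 0, by simp⟩
    obtain ⟨F, ⟨⟨x, hx⟩, l, hl⟩, hF⟩ := h1
    have hFP : F ⊆ P := by rw [hl]; exact fun _ hy => hy.1
    refine ⟨x, hFP hx, fun w => ⟨fun hw => ?_, fun hw => ?_⟩⟩
    · rw [hF] at hw
      exact hw x hx
    · rw [hF]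
      intro x' hx'
      have : x' = x := Φ.eq_of_ray_gen_eq (σ := σ) fun j => by
        have hj := Φ.ray_gen_mem σ j
        rw [hF] at hj
        exact le_antisymm (hj x hx _ (hFP hx')) (hj x' hx' _ (hFP hx))
      rwa [this]
  choose v hv hv' using key
  exact ⟨v, hv, hv'⟩

namespace IsVertexSystem

variable {P : Set V} {v : K → V} (hv : Φ.IsVertexSystem P v)
include hv

theorem apply_le {σ : K} {w : Module.Dual ℝ V} (hw : w ∈ Φ.cone σ) {y : V} (hy : y ∈ P) :
    w y ≤ w (v σ) := (hv.mem_cone_iff σ w).1 hw y hy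

theorem isVertex (σ : K) : IsVertex P (v σ) := by
  refine ⟨⟨_, rfl⟩, ∑ j, Φ.ray (Φ.gen σ j), ?_⟩
  have hmem := Φ.sum_ray_gen_mem σ Finset.univ
  ext x
  constructor
  · rintro rfl
    exact ⟨hv.mem σ, fun y hy => hv.apply_le hmem hy⟩
  · rintro ⟨hx, hmax⟩
    refine Φ.eq_of_ray_gen_eq (σ := σ) fun j => ?_
    exact ray_gen_eq_of_sum_le (fun j _ => hv.apply_le (Φ.ray_gen_mem σ j) hx)
      (hmax _ (hv.mem σ)) j (Finset.mem_univ j)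

theorem exists_eq_of_isVertex {x : V} (hx : IsVertex P x) : ∃ σ, v σ = x := by
  obtain ⟨-, l, hl⟩ := hx
  obtain ⟨σ, hσ⟩ := Φ.complete l
  have : v σ ∈ ({x} : Set V) := by
    rw [hl]
    exact ⟨hv.mem σ, fun y hy => hv.apply_le hσ hy⟩
  exact ⟨σ, this⟩

/-- If `l` lies in the normal cone at `v σ`, and among the vertices with maximal `l` the functional
`w` is maximal at `v σ`, then a small perturbation of `l` in the direction of `w` stays in the
normal cone at `v σ`. -/
theorem exists_add_smul_mem [Finite K] {σ : K} {l w : Module.Dual ℝ V} (hl : l ∈ Φ.cone σ)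
    (hw : ∀ σ', l (v σ') = l (v σ) → w (v σ') ≤ w (v σ)) :
    ∃ ε : ℝ, 0 < ε ∧ l + ε • w ∈ Φ.cone σ := by
  have key : ∀ᶠ ε : ℝ in nhdsWithin 0 (Set.Ioi 0),
      ∀ σ', (l + ε • w) (v σ') ≤ (l + ε • w) (v σ) := by
    rw [Filter.eventually_all]
    intro σ'
    simp only [LinearMap.add_apply, LinearMap.smul_apply, smul_eq_mul]
    rcases (hv.apply_le hl (hv.mem σ')).eq_or_lt with h | h
    · filter_upwards [self_mem_nhdsWithin] with ε hε
      rw [h]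
      exact add_le_add le_rfl (mul_le_mul_of_nonneg_left (hw σ' h) (le_of_lt hε))
    · refine nhdsWithin_le_nhds ?_
      have h1 : Continuous fun ε : ℝ => l (v σ') + ε * w (v σ') := by fun_prop
      have h2 : Continuous fun ε : ℝ => l (v σ) + ε * w (v σ) := by fun_prop
      have h3 : l (v σ') + 0 * w (v σ') < l (v σ) + 0 * w (v σ) := by simpa using h
      exact ((h1.tendsto 0).eventually_lt (h2.tendsto 0) h3).mono fun _ h => h.le
  obtain ⟨ε, h1, hε⟩ := (key.and self_mem_nhdsWithin).exists
  refine ⟨ε, hε, (hv.mem_cone_iff _ _).2 fun y hy => ?_⟩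
  obtain ⟨σ', hσ'⟩ := Φ.complete (l + ε • w)
  exact (hv.apply_le hσ' hy).trans (h1 σ')

/-- A functional that is constant on the face where the generator `j` of `σ` is maximal is a
multiple of that generator. -/
theorem eq_smul_ray_gen [Finite K] {σ : K} {j : κ} {w : Module.Dual ℝ V}
    (hw : ∀ σ', Φ.ray (Φ.gen σ j) (v σ') = Φ.ray (Φ.gen σ j) (v σ) → w (v σ') = w (v σ)) :
    w = w (Φ.coord σ j) • Φ.ray (Φ.gen σ j) := by
  have hl := Φ.ray_gen_mem σ j
  obtain ⟨ε, hε, h1⟩ := hv.exists_add_smul_mem hl (w := w) fun σ' h => (hw σ' h).le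
  obtain ⟨ε', hε', h2⟩ := hv.exists_add_smul_mem hl (w := -w) fun σ' h => by simp [hw σ' h]
  have h0 : ∀ k, k ≠ j → w (Φ.coord σ k) = 0 := by
    intro k hk
    have h1 := h1 k
    have h2 := h2 k
    simp only [LinearMap.add_apply, LinearMap.smul_apply, LinearMap.neg_apply, smul_eq_mul,
      Φ.ray_coord, if_neg hk.symm, zero_add] at h1 h2
    nlinarith
  conv_lhs => rw [Φ.expand σ w]
  exact Finset.sum_eq_single j (fun k _ hk => by rw [h0 k hk, zero_smul]) (by simp)

/-- The rays of `Φ` are the facet normals of `P`, and the vertex `v σ` lies on the facet `i` only if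
`ray i` belongs to the cone `σ`. -/
theorem exists_isFacetDescription [Finite K] [FiniteDimensional ℝ V] [Nonempty K]
    (hP : IsPolytope P) :
    ∃ b₀, IsFacetDescription P Φ.ray b₀ ∧ ∀ σ i, Φ.ray i (v σ) = b₀ i → Φ.ray i ∈ Φ.cone σ := by
  have hex : ∀ i, ∃ c, (∀ y ∈ P, Φ.ray i y ≤ c) ∧
      ∀ σ, Φ.ray i ∈ Φ.cone σ → Φ.ray i (v σ) = c := by
    intro i
    obtain ⟨σ, j, rfl⟩ := Φ.exists_gen i
    exact ⟨_, fun y hy => hv.apply_le (Φ.ray_gen_mem σ j) hy, fun σ' h' =>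
      le_antisymm (hv.apply_le (Φ.ray_gen_mem σ j) (hv.mem _)) (hv.apply_le h' (hv.mem _))⟩
  choose b₀ hle heq using hex
  have hgen : ∀ σ j, Φ.ray (Φ.gen σ j) (v σ) = b₀ (Φ.gen σ j) :=
    fun σ j => heq _ σ (Φ.ray_gen_mem σ j)
  -- A functional that is constant on the facet `i` is a multiple of `ray i`.
  have hfac : ∀ i (w : Module.Dual ℝ V),
      (∀ x y, x ∈ P → y ∈ P → Φ.ray i x = b₀ i → Φ.ray i y = b₀ i → w x = w y) →
      ∃ σ j, Φ.gen σ j = i ∧ w = w (Φ.coord σ j) • Φ.ray i := by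
    intro i w hw
    obtain ⟨σ, j, rfl⟩ := Φ.exists_gen i
    refine ⟨σ, j, rfl, hv.eq_smul_ray_gen fun σ' h => ?_⟩
    exact hw _ _ (hv.mem _) (hv.mem _) (h.trans (hgen σ j)) (hgen σ j)
  have hne : ∀ i, Φ.ray i ≠ 0 := by
    intro i
    obtain ⟨σ, j, rfl⟩ := Φ.exists_gen i
    intro h
    have := Φ.ray_coord σ j j
    simp [h] at this
  have hface : ∀ i, {x ∈ P | Φ.ray i x = b₀ i} = {x ∈ P | ∀ y ∈ P, Φ.ray i y ≤ Φ.ray i x} := by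
    intro i
    obtain ⟨σ, j, rfl⟩ := Φ.exists_gen i
    ext x
    refine and_congr_right fun hx => ⟨fun h y hy => (hle _ y hy).trans h.ge, fun h => ?_⟩
    exact le_antisymm (hle _ _ hx) ((hgen σ j).symm.le.trans (h _ (hv.mem σ)))
  have hnonempty : ∀ i, ∃ x ∈ P, Φ.ray i x = b₀ i := by
    intro i
    obtain ⟨σ, j, rfl⟩ := Φ.exists_gen i
    exact ⟨v σ, hv.mem σ, hgen σ j⟩
  refine ⟨b₀, ⟨hP, ?_, ?_, ?_, ?_⟩, ?_⟩
  · -- A functional that is constant on `P` lies, with its negative, in a pointed cone.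
    obtain ⟨σ⟩ := ‹Nonempty K›
    rw [AffineSubspace.affineSpan_eq_top_iff_vectorSpan_eq_top_of_nonempty ℝ V V ⟨v σ, hv.mem σ⟩]
    by_contra htop
    obtain ⟨w, hw0, hw⟩ := Submodule.exists_le_ker_of_lt_top _ (lt_top_iff_ne_top.2 htop)
    have hconst : ∀ y ∈ P, w y = w (v σ) := fun y hy => by
      have := hw (vsub_mem_vectorSpan ℝ hy (hv.mem σ))
      simpa [sub_eq_zero] using this
    have h1 : w ∈ Φ.cone σ := (hv.mem_cone_iff σ w).2 fun y hy => (hconst y hy).le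
    have h2 : -w ∈ Φ.cone σ := (hv.mem_cone_iff σ _).2 fun y hy => by simp [hconst y hy]
    apply hw0
    rw [Φ.expand σ w]
    refine Finset.sum_eq_zero fun j _ => ?_
    have h3 := h1 j
    have h4 := h2 j
    simp only [LinearMap.neg_apply] at h4
    rw [show w (Φ.coord σ j) = 0 by linarith, zero_smul]
  · ext x
    refine ⟨fun hx i => hle i x hx, fun hx => ?_⟩
    obtain ⟨-, s, hs⟩ := hP
    rw [hs]
    intro c hc
    obtain ⟨σ, hσ⟩ := Φ.complete c.1
    have h1 : c.1 x ≤ c.1 (v σ) :=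
      apply_le_of_forall_ray_le hσ fun j => (hx _).trans (hgen σ j).ge
    have h2 := hv.mem σ
    rw [hs] at h2
    exact h1.trans (h2 c hc)
  · intro i
    obtain ⟨x₀, hx₀, hx₀'⟩ := hnonempty i
    refine ⟨⟨⟨x₀, hx₀, hx₀'⟩, Φ.ray i, hface i⟩, ?_⟩
    have : vectorSpan ℝ {x ∈ P | Φ.ray i x = b₀ i} = LinearMap.ker (Φ.ray i) := by
      apply le_antisymm
      · rw [vectorSpan, Submodule.span_le]
        rintro _ ⟨x, hx, y, hy, rfl⟩
        simp [hx.2, hy.2]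
      · intro x hx
        by_contra hx'
        obtain ⟨w, hwx, hw⟩ := Submodule.exists_le_ker_of_notMem hx'
        obtain ⟨σ, j, -, hσ⟩ := hfac i w fun x y hx hy hx' hy' => by
          have := hw (vsub_mem_vectorSpan ℝ (⟨hx, hx'⟩ : x ∈ {x ∈ P | Φ.ray i x = b₀ i}) ⟨hy, hy'⟩)
          simpa [sub_eq_zero] using this
        apply hwx
        rw [hσ, LinearMap.smul_apply, LinearMap.mem_ker.1 hx, smul_zero]
    rw [this]
    exact Module.Dual.finrank_ker_add_one_of_ne_zero (hne i)
  · intro i i' hii'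
    simp only at hii'
    have hset : ∀ x, (x ∈ P ∧ Φ.ray i x = b₀ i) ↔ (x ∈ P ∧ Φ.ray i' x = b₀ i') :=
      fun x => Set.ext_iff.1 hii' x
    obtain ⟨σ, j, hj, h⟩ := hfac i' (Φ.ray i) fun x y hx hy hx' hy' => by
      rw [((hset x).2 ⟨hx, hx'⟩).2, ((hset y).2 ⟨hy, hy'⟩).2]
    refine Φ.ray_injective i' i _ (lt_of_le_of_ne ?_ ?_) h
    · have h1 : v σ ∈ P ∧ Φ.ray i' (v σ) = b₀ i' := ⟨hv.mem σ, by rw [← hj]; exact hgen σ j⟩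
      have h2 := (hset _).2 h1
      have h3 : Φ.ray i ∈ Φ.cone σ :=
        (hv.mem_cone_iff σ _).2 fun y hy => (hle i y hy).trans h2.2.ge
      exact h3 j
    · intro h0
      rw [← h0, zero_smul] at h
      exact hne i h
  · intro σ i hi
    exact (hv.mem_cone_iff σ _).2 fun y hy => (hle i y hy).trans hi.ge

/-- The deformation cone of a polytope with the vertex system `v` depends on the fan only. -/
theorem deformationCone_eq [Finite K] [Finite ι] [FiniteDimensional ℝ V] [Nonempty K]
    (hP : IsPolytope P) :
    deformationCone P Φ.ray = Φ.nefCone := by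
  ext b
  constructor
  · rintro ⟨b₀, Q, hP', -, hQ, hQ'⟩ σ i
    obtain ⟨u, hu, hu'⟩ := hQ' _ (hv.isVertex σ)
    have huQ : u ∈ Q := by
      obtain ⟨-, l, hl⟩ := hu
      have : u ∈ ({u} : Set V) := rfl
      rw [hl] at this
      exact this.1
    have hus : ∀ i, Φ.ray i (v σ) = b₀ i → Φ.ray i u = b i := by
      have : u ∈ ({u} : Set V) := rfl
      rw [← hu'] at this
      exact this
    have hpt : u = Φ.point b σ := Φ.eq_of_ray_gen_eq (σ := σ) fun j => by
      rw [Φ.ray_gen_point]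
      apply hus
      obtain ⟨x, hx, hx'⟩ := (hP'.facet (Φ.gen σ j)).1.1
      apply le_antisymm
      · have := hv.mem σ
        rw [hP'.eq_setOf] at this
        exact this _
      · rw [← hx']
        exact hv.apply_le (Φ.ray_gen_mem σ j) hx
    rw [← hpt]
    rw [hQ] at huQ
    exact huQ i
  · intro hb
    obtain ⟨b₀, hb₀, hcone⟩ := hv.exists_isFacetDescription hP
    have := Fintype.ofFinite ι
    refine ⟨b₀, {x | ∀ i, Φ.ray i x ≤ b i}, hb₀, ⟨?_, ?_⟩, rfl, ?_⟩
    · refine isBounded_of_forall_dual_le fun w => ?_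
      obtain ⟨σ, hσ⟩ := Φ.complete w
      refine ⟨w (Φ.point b σ), fun x hx => apply_le_of_forall_ray_le hσ fun j => ?_⟩
      rw [Φ.ray_gen_point]
      exact hx _
    · classical
      refine ⟨Finset.univ.image fun i => (Φ.ray i, b i), ?_⟩
      ext x
      simp
    · intro x hx
      obtain ⟨σ, rfl⟩ := hv.exists_eq_of_isVertex hx
      refine ⟨Φ.point b σ, ⟨⟨_, rfl⟩, ∑ j, Φ.ray (Φ.gen σ j), ?_⟩, ?_⟩
      · ext x
        constructor
        · rintro rfl
          refine ⟨hb σ, fun y hy => apply_le_of_forall_ray_le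
            (Φ.sum_ray_gen_mem σ Finset.univ) fun j => ?_⟩
          rw [Φ.ray_gen_point]
          exact hy _
        · rintro ⟨hx, hmax⟩
          refine Φ.eq_of_ray_gen_eq (σ := σ) fun j => ?_
          refine ray_gen_eq_of_sum_le (fun j _ => ?_) (hmax _ (hb σ)) j (Finset.mem_univ j)
          rw [Φ.ray_gen_point]
          exact hx _
      · ext x
        constructor
        · intro hx
          refine Φ.eq_of_ray_gen_eq (σ := σ) fun j => ?_
          rw [Φ.ray_gen_point]
          refine hx _ (le_antisymm ?_ ?_)
          · have := hv.mem σ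
            rw [hb₀.eq_setOf] at this
            exact this _
          · obtain ⟨y, hy, hy'⟩ := (hb₀.facet (Φ.gen σ j)).1.1
            rw [← hy']
            exact hv.apply_le (Φ.ray_gen_mem σ j) hy
        · rintro rfl i hi
          exact ray_point_eq_of_mem_nefCone hb (hcone σ i hi)

/-- The normal fan of a polytope with the vertex system `v` consists of the cones of `Φ` and of
their faces. -/
theorem normalFan_eq [Finite K] : normalFan P = {F | ∃ σ, IsFace (Φ.cone σ) F} := by
  classical
  have := Fintype.ofFinite K
  ext G
  constructor
  · rintro ⟨F, ⟨-, l, hl⟩, rfl⟩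
    obtain ⟨σ, hσ⟩ := Φ.complete l
    have hvF : ∀ σ', v σ' ∈ F ↔ l (v σ') = l (v σ) := by
      intro σ'
      rw [hl]
      refine ⟨fun h => le_antisymm (hv.apply_le hσ (hv.mem _)) (h.2 _ (hv.mem _)), fun h => ?_⟩
      exact ⟨hv.mem _, fun y hy => h ▸ hv.apply_le hσ hy⟩
    have hσF : v σ ∈ F := (hvF σ).2 rfl
    have hFP : F ⊆ P := by rw [hl]; exact fun _ h => h.1
    -- The functional that cuts out the face is given by the vertices of `F`, relative to `v σ`.
    refine ⟨σ, ⟨0, fun _ _ _ _ => le_rfl⟩,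
      Module.Dual.eval ℝ V (∑ σ' with v σ' ∈ F, (v σ' - v σ)), ?_⟩
    have hm : ∀ w : Module.Dual ℝ V, Module.Dual.eval ℝ V (∑ σ' with v σ' ∈ F, (v σ' - v σ)) w =
        ∑ σ' with v σ' ∈ F, (w (v σ') - w (v σ)) := by
      intro w
      simp [Module.Dual.eval_apply]
    have hterm : ∀ w ∈ Φ.cone σ, ∀ σ' ∈ Finset.univ.filter (fun σ' => v σ' ∈ F),
        w (v σ') - w (v σ) ≤ 0 :=
      fun w hw σ' _ => sub_nonpos.2 (hv.apply_le hw (hv.mem _))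
    ext w
    constructor
    · intro hw
      refine ⟨(hv.mem_cone_iff σ w).2 (hw _ hσF), fun y hy => ?_⟩
      rw [hm, hm]
      refine (Finset.sum_nonpos (hterm y hy)).trans (Finset.sum_nonneg fun σ' hσ' => ?_)
      rw [sub_nonneg]
      exact hw _ (Finset.mem_filter.1 hσ').2 _ (hv.mem _)
    · rintro ⟨hw, hmax⟩
      have h0 := hmax 0 (Φ.zero_mem_cone σ)
      rw [map_zero, hm] at h0
      have h1 := (Finset.sum_eq_zero_iff_of_nonpos (hterm w hw)).1
        (le_antisymm (Finset.sum_nonpos (hterm w hw)) h0)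
      obtain ⟨ε, hε, h2⟩ := hv.exists_add_smul_mem hσ (w := -w) fun σ' h => by
        have := h1 σ' (Finset.mem_filter.2 ⟨Finset.mem_univ _, (hvF σ').2 h⟩)
        simp only [LinearMap.neg_apply]
        linarith
      intro x hx y hy
      have h3 := hv.apply_le h2 (hFP hx)
      have h4 : l (v σ) ≤ l x := by
        rw [hl] at hx
        exact hx.2 _ (hv.mem _)
      simp only [LinearMap.add_apply, LinearMap.smul_apply, LinearMap.neg_apply, smul_eq_mul] at h3
      have h5 : w (v σ) ≤ w x := by
        by_contra hlt
        nlinarith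
      exact (hv.apply_le hw hy).trans h5
  · rintro ⟨σ, ⟨w₀, hw₀⟩, m, hm⟩
    have hG : ∀ w, w ∈ G ↔ w ∈ Φ.cone σ ∧ ∀ y ∈ Φ.cone σ, m y ≤ m w := fun w => by
      rw [hm]; rfl
    obtain ⟨hw₀, hmax⟩ := (hG w₀).1 hw₀
    have hm0 : m w₀ = 0 := by
      have h1 := hmax 0 (Φ.zero_mem_cone σ)
      have h2 := hmax ((2 : ℝ) • w₀) fun j => by
        have := hw₀ j
        simp only [LinearMap.smul_apply, smul_eq_mul]
        positivity
      rw [map_zero] at h1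
      rw [map_smul, smul_eq_mul] at h2
      linarith
    rw [hm0] at hmax
    have hG' : ∀ w, w ∈ G ↔ w ∈ Φ.cone σ ∧
        ∀ j, m (Φ.ray (Φ.gen σ j)) ≠ 0 → w (Φ.coord σ j) = 0 := by
      intro w
      rw [hG]
      refine and_congr_right fun hw => ?_
      have hmw : m w = ∑ j, w (Φ.coord σ j) * m (Φ.ray (Φ.gen σ j)) := by
        conv_lhs => rw [Φ.expand σ w]
        simp
      have hneg : ∀ j ∈ Finset.univ, w (Φ.coord σ j) * m (Φ.ray (Φ.gen σ j)) ≤ 0 := fun j _ =>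
        mul_nonpos_of_nonneg_of_nonpos (hw j) (hmax _ (Φ.ray_gen_mem σ j))
      constructor
      · intro h j hj
        have h1 := h _ hw₀
        rw [hm0, hmw] at h1
        have h2 := (Finset.sum_eq_zero_iff_of_nonpos hneg).1
          (le_antisymm (Finset.sum_nonpos hneg) h1) j (Finset.mem_univ j)
        exact (mul_eq_zero.1 h2).resolve_right hj
      · intro h y hy
        refine (hmax y hy).trans (le_of_eq ?_)
        rw [hmw]
        symm
        refine Finset.sum_eq_zero fun j _ => ?_
        by_cases hj : m (Φ.ray (Φ.gen σ j)) = 0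
        · rw [hj, mul_zero]
        · rw [h j hj, zero_mul]
    set J : Finset κ := Finset.univ.filter fun j => m (Φ.ray (Φ.gen σ j)) = 0 with hJ
    set l := ∑ j ∈ J, Φ.ray (Φ.gen σ j) with hl
    have hlσ : l ∈ Φ.cone σ := Φ.sum_ray_gen_mem σ J
    have hσF : v σ ∈ {x ∈ P | ∀ y ∈ P, l y ≤ l x} :=
      ⟨hv.mem σ, fun y hy => hv.apply_le hlσ hy⟩
    refine ⟨_, ⟨⟨v σ, hσF⟩, l, rfl⟩, ?_⟩
    ext w
    rw [hG']
    constructor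
    · rintro ⟨hw, h0⟩ x ⟨hx, hxmax⟩ y hy
      refine (hv.apply_le hw hy).trans (le_of_eq ?_)
      rw [Φ.apply_eq σ w, Φ.apply_eq σ w x]
      refine Finset.sum_congr rfl fun j _ => ?_
      by_cases hj : m (Φ.ray (Φ.gen σ j)) = 0
      · rw [ray_gen_eq_of_sum_le (fun j _ => hv.apply_le (Φ.ray_gen_mem σ j) hx)
          (hxmax _ (hv.mem σ)) j (by simp [hJ, hj])]
      · rw [h0 j hj, zero_mul, zero_mul]
    · intro hw
      refine ⟨(hv.mem_cone_iff σ w).2 (hw _ hσF), fun j hj => ?_⟩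
      obtain ⟨ε, hε, h1⟩ := hv.exists_add_smul_mem hlσ (w := -w) fun σ' h => by
        have := hw (v σ') ⟨hv.mem _, fun y hy => h ▸ hv.apply_le hlσ hy⟩ (v σ) (hv.mem _)
        simpa using this
      have h2 := h1 j
      have h3 : l (Φ.coord σ j) = 0 := by
        rw [hl, LinearMap.sum_apply]
        refine Finset.sum_eq_zero fun k hk => ?_
        rw [Φ.ray_coord, if_neg]
        rintro rfl
        exact hj (by simpa [hJ] using hk)
      have h4 := (hv.mem_cone_iff σ w).2 (hw _ hσF) j
      simp only [LinearMap.add_apply, h3, LinearMap.smul_apply, LinearMap.neg_apply, smul_eq_mul,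
        zero_add] at h2
      nlinarith

end IsVertexSystem

/-- If every functional in the cone `σ` is maximal, among the points `v σ'`, at `v σ`, and at no
`v σ'` whose cone does not contain it, then the convex hull of these points is a polytope with the
vertex system `v`. -/
theorem isVertexSystem_convexHull [Finite K] [Finite ι] [FiniteDimensional ℝ V] {v : K → V}
    (hmax : ∀ σ σ' w, w ∈ Φ.cone σ → w (v σ') ≤ w (v σ))
    (heq : ∀ σ σ' w, w ∈ Φ.cone σ → w (v σ') = w (v σ) → w ∈ Φ.cone σ') :
    IsPolytope (convexHull ℝ (Set.range v)) ∧
      Φ.IsVertexSystem (convexHull ℝ (Set.range v)) v := by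
  have hle : ∀ σ w, w ∈ Φ.cone σ → ∀ y ∈ convexHull ℝ (Set.range v), w y ≤ w (v σ) := by
    intro σ w hw y hy
    have : convexHull ℝ (Set.range v) ⊆ {y | w y ≤ w (v σ)} := by
      apply convexHull_min
      · rintro _ ⟨σ', rfl⟩
        exact hmax σ σ' w hw
      · exact convex_halfSpace_le w.isLinear _
    exact this hy
  have hmem : ∀ σ, v σ ∈ convexHull ℝ (Set.range v) :=
    fun σ => subset_convexHull ℝ _ ⟨σ, rfl⟩
  have hcomp := (Set.finite_range v).isCompact_convexHull ℝ
  refine ⟨⟨hcomp.isBounded, ?_⟩, hmem, fun σ w => ⟨hle σ w, fun h => ?_⟩⟩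
  · classical
    have := Fintype.ofFinite ι
    have hex : ∀ i, ∃ σ, Φ.ray i ∈ Φ.cone σ := fun i => Φ.complete _
    choose s hs using hex
    refine ⟨Finset.univ.image fun i => (Φ.ray i, Φ.ray i (v (s i))), ?_⟩
    ext x
    simp only [Finset.mem_image, Finset.mem_univ, true_and, forall_exists_index,
      forall_apply_eq_imp_iff, Set.mem_ofPred_eq]
    refine ⟨fun hx i => hle _ _ (hs i) x hx, fun hx => ?_⟩
    by_contra hx'
    obtain ⟨f, c, hf, hc⟩ := geometric_hahn_banach_closed_point (convex_convexHull ℝ _)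
      hcomp.isClosed hx'
    obtain ⟨σ, hσ⟩ := Φ.complete (f : Module.Dual ℝ V)
    have h1 : (f : Module.Dual ℝ V) x ≤ (f : Module.Dual ℝ V) (v σ) :=
      apply_le_of_forall_ray_le hσ fun j => (hx _).trans (hmax _ _ _ (Φ.ray_gen_mem σ j))
    have h2 := hf _ (hmem σ)
    simp only [ContinuousLinearMap.coe_coe] at h1
    linarith
  · obtain ⟨σ', hσ'⟩ := Φ.complete w
    exact heq σ' σ w hσ' (le_antisymm (hmax _ _ _ hσ') (h _ (hmem σ')))

end CompleteSimplicialFan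

open OrderedSetPartition

/-! ### Ordered set partitions as cut sets of a permutation -/

/-- The number of cuts `k ∈ A` in front of the position `p`, where the cut `k` lies between the
positions `k` and `k + 1`. -/
def cutCount {d : ℕ} (A : Finset (Fin d)) (p : Fin (d + 1)) : ℕ :=
  (A.filter fun k => k.castSucc < p).card

section CutCount

variable {d : ℕ} (A : Finset (Fin d))

@[simp]
theorem cutCount_zero : cutCount A 0 = 0 := by
  simp [cutCount]

theorem cutCount_succ (k : Fin d) :
    cutCount A k.succ = cutCount A k.castSucc + if k ∈ A then 1 else 0 := by
  unfold cutCount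
  split_ifs with h
  · rw [← Finset.card_insert_of_notMem (a := k) (by simp)]
    congr 1
    ext l
    simp only [Finset.mem_filter, Finset.mem_insert, Fin.castSucc_lt_succ_iff,
      Fin.castSucc_lt_castSucc_iff, le_iff_lt_or_eq]
    constructor
    · rintro ⟨h1, h2 | h2⟩ <;> tauto
    · rintro (rfl | h2) <;> tauto
  · rw [add_zero]
    congr 1
    ext l
    simp only [Finset.mem_filter, Fin.castSucc_lt_succ_iff, Fin.castSucc_lt_castSucc_iff,
      le_iff_lt_or_eq]
    constructor
    · rintro ⟨h1, h2 | rfl⟩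
      · exact ⟨h1, h2⟩
      · exact absurd h1 h
    · tauto

theorem cutCount_lt_iff {p q : Fin (d + 1)} :
    cutCount A p < cutCount A q ↔ ∃ k ∈ A, p ≤ k.castSucc ∧ k.castSucc < q := by
  constructor
  · intro h
    by_contra! hc
    refine absurd (Finset.card_le_card ?_) (not_le.2 h)
    intro k hk
    rw [Finset.mem_filter] at hk ⊢
    refine ⟨hk.1, ?_⟩
    by_contra hkp
    exact absurd hk.2 (not_lt.2 (hc k hk.1 (not_lt.1 hkp)))
  · rintro ⟨k, hk, h1, h2⟩
    refine Finset.card_lt_card (Finset.ssubset_iff_subset_ne.2 ⟨?_, ?_⟩)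
    · exact Finset.monotone_filter_right A fun l _ hl => lt_trans hl (lt_of_le_of_lt h1 h2)
    · intro h
      have h3 : k ∈ A.filter fun k => k.castSucc < q := Finset.mem_filter.2 ⟨hk, h2⟩
      rw [← h, Finset.mem_filter] at h3
      exact absurd h3.2 (not_lt.2 h1)

theorem cutCount_univ (p : Fin (d + 1)) : cutCount (Finset.univ : Finset (Fin d)) p = p := by
  induction p using Fin.induction with
  | zero => simp
  | succ k ih => rw [cutCount_succ, ih]; simp

theorem cutCount_last : cutCount A (Fin.last d) = A.card := by
  unfold cutCount
  rw [Finset.filter_true_of_mem fun k _ => Fin.castSucc_lt_last k]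

theorem isLowerSet_range_cutCount : IsLowerSet (Set.range (cutCount A)) := by
  have key : ∀ q m, m ≤ cutCount A q → ∃ p, cutCount A p = m := by
    intro q
    induction q using Fin.induction with
    | zero => exact fun m hm => ⟨0, by rw [cutCount_zero] at hm ⊢; omega⟩
    | succ k ih =>
      intro m hm
      by_cases h : m ≤ cutCount A k.castSucc
      · exact ih m h
      · refine ⟨k.succ, ?_⟩
        rw [cutCount_succ] at hm ⊢
        split_ifs at hm ⊢ <;> omega
  rintro a b hba ⟨q, rfl⟩
  exact key q b hba

end CutCount

/-- The ordered set partition obtained from `π⁻¹(0) π⁻¹(1) ⋯ π⁻¹(d)` by inserting a bar between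
the positions `k` and `k + 1` for every `k ∈ A`. -/
def cut {d : ℕ} (π : Equiv.Perm (Fin (d + 1))) (A : Finset (Fin d)) :
    OrderedSetPartition (d + 1) where
  label x := cutCount A (π x)
  isLowerSet_range := by
    have := isLowerSet_range_cutCount A
    rwa [← π.surjective.range_comp] at this

section Cut

variable {d : ℕ} {π : Equiv.Perm (Fin (d + 1))} {A B : Finset (Fin d)}

@[simp]
theorem cut_label (x : Fin (d + 1)) : (cut π A).label x = cutCount A (π x) := rfl

theorem cut_le_cut : cut π A ≤ cut π B ↔ B ⊆ A := by
  constructor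
  · intro h k hk
    by_contra hkA
    have h1 := h (π.symm k.succ) (π.symm k.castSucc)
    simp only [cut_label, Equiv.apply_symm_apply, cutCount_succ, if_pos hk, if_neg hkA] at h1
    omega
  · intro h x y hxy
    simp only [cut_label] at hxy ⊢
    contrapose! hxy
    rw [cutCount_lt_iff] at hxy ⊢
    obtain ⟨k, hk, h1⟩ := hxy
    exact ⟨k, h hk, h1⟩

theorem cut_injective : Function.Injective (cut π) := fun _ _ h =>
  Finset.Subset.antisymm (cut_le_cut.1 h.ge) (cut_le_cut.1 h.le)

theorem cut_univ : cut π Finset.univ = ofPerm π := by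
  ext x
  rw [cut_label, cutCount_univ]
  rfl

theorem cut_empty : cut π ∅ = ⊤ := by
  ext x
  simp [cutCount]
  rfl

theorem cut_ne_top (hA : A.Nonempty) : cut π A ≠ ⊤ := fun h =>
  hA.ne_empty (cut_injective (h.trans cut_empty.symm))

theorem ofPerm_le_cut : ofPerm π ≤ cut π A := by
  rw [← cut_univ, cut_le_cut]
  exact Finset.subset_univ _

theorem exists_eq_cut {S : OrderedSetPartition (d + 1)} (h : ofPerm π ≤ S) :
    ∃ A, S = cut π A := by
  have hmono : Monotone fun p => S.label (π.symm p) := by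
    intro p q hpq
    apply h
    simpa [ofPerm] using hpq
  refine ⟨Finset.univ.filter fun k : Fin d =>
    S.label (π.symm k.castSucc) ≠ S.label (π.symm k.succ), ?_⟩
  have key : ∀ p q : Fin (d + 1), (∀ k : Fin d, p ≤ k.castSucc → k.castSucc < q →
      S.label (π.symm k.castSucc) = S.label (π.symm k.succ)) →
      S.label (π.symm q) ≤ S.label (π.symm p) := by
    intro p q
    induction q using Fin.induction with
    | zero => exact fun _ => hmono (Fin.zero_le p)
    | succ k ih =>
      intro hk
      rcases le_or_gt p k.castSucc with hp | hp
      · rw [← hk k hp Fin.castSucc_lt_succ]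
        exact ih fun l h1 h2 => hk l h1 (h2.trans Fin.castSucc_lt_succ)
      · exact hmono (Fin.castSucc_lt_iff_succ_le.1 hp)
  apply le_antisymm
  · intro x y hxy
    simp only [cut_label]
    by_contra! hc
    rw [cutCount_lt_iff] at hc
    obtain ⟨k, hk, h1, h2⟩ := hc
    have h3 := hmono h1
    have h4 := hmono (Fin.castSucc_lt_iff_succ_le.1 h2)
    have h5 := hmono (Fin.castSucc_lt_succ (i := k)).le
    have h6 := (Finset.mem_filter.1 hk).2
    simp only [Equiv.symm_apply_apply] at h3 h4 h5
    omega
  · intro x y hxy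
    simp only [cut_label] at hxy
    have h1 := key (π y) (π x) fun k h1 h2 => by
      by_contra hne
      refine absurd ((cutCount_lt_iff _).2 ⟨k, ?_, h1, h2⟩) (not_lt.2 hxy)
      exact Finset.mem_filter.2 ⟨Finset.mem_univ _, hne⟩
    simpa using h1

theorem exists_ofPerm_le (S : OrderedSetPartition (d + 1)) : ∃ π, ofPerm π ≤ S := by
  refine ⟨(Tuple.sort S.label).symm, fun i j hij => ?_⟩
  have h := Tuple.monotone_sort S.label (Fin.le_def.2 hij)
  simpa using h

theorem cut_covBy_cut : cut π A ⋖ cut π B ↔ B ⋖ A := by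
  constructor
  · intro h
    refine ⟨lt_of_le_not_ge (cut_le_cut.1 h.le) fun h' => h.lt.not_ge (cut_le_cut.2 h'), ?_⟩
    intro C h1 h2
    refine h.2 (c := cut π C) (lt_of_le_not_ge (cut_le_cut.2 h2.le) fun h' => ?_)
      (lt_of_le_not_ge (cut_le_cut.2 h1.le) fun h' => ?_)
    · exact h2.not_ge (cut_le_cut.1 h')
    · exact h1.not_ge (cut_le_cut.1 h')
  · intro h
    refine ⟨lt_of_le_not_ge (cut_le_cut.2 h.le) fun h' => h.lt.not_ge (cut_le_cut.1 h'), ?_⟩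
    intro X h1 h2
    obtain ⟨C, rfl⟩ := exists_eq_cut (ofPerm_le_cut.trans h1.le)
    refine h.2 (c := C) (lt_of_le_not_ge (cut_le_cut.1 h2.le) fun h' => ?_)
      (lt_of_le_not_ge (cut_le_cut.1 h1.le) fun h' => ?_)
    · exact h2.not_ge (cut_le_cut.2 h')
    · exact h1.not_ge (cut_le_cut.2 h')

theorem rank_cut : (cut π A).rank = d - A.card := by
  have : Finset.univ.image (cut π A).label = Finset.range (A.card + 1) := by
    ext m
    simp only [Finset.mem_image, Finset.mem_univ, true_and, cut_label, Finset.mem_range]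
    constructor
    · rintro ⟨x, rfl⟩
      exact Nat.lt_succ_of_le (Finset.card_filter_le _ _)
    · intro hm
      obtain ⟨p, hp⟩ := isLowerSet_range_cutCount A (Nat.le_of_lt_succ hm)
        ⟨Fin.last d, cutCount_last A⟩
      exact ⟨π.symm p, by simpa using hp⟩
  rw [OrderedSetPartition.rank, numBlocks, this, Finset.card_range]
  omega

/-- The value of `b` at the partition with the cut set `A`, as a set function of `A`. -/
noncomputable def cutValue {d : ℕ} (b : ProperOSP d → ℝ) (π : Equiv.Perm (Fin (d + 1)))
    (A : Finset (Fin d)) : ℝ := extend b (cut π A)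

theorem cutValue_empty (b : ProperOSP d → ℝ) : cutValue b π ∅ = 0 := by
  simp [cutValue, extend, cut_empty]

theorem cutValue_of_nonempty (b : ProperOSP d → ℝ) (hA : A.Nonempty) :
    cutValue b π A = b ⟨cut π A, cut_ne_top hA⟩ := by
  simp [cutValue, extend, cut_ne_top hA]

theorem locallySubmodular_iff {b : ProperOSP d → ℝ} : LocallySubmodular b ↔
    ∀ π A B, cutValue b π (A ∩ B) + cutValue b π (A ∪ B) ≤ cutValue b π A + cutValue b π B := by
  have hlub : ∀ (π : Equiv.Perm (Fin (d + 1))) (A B : Finset (Fin d)),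
      IsLUB ({⟨cut π A, ofPerm_le_cut⟩, ⟨cut π B, ofPerm_le_cut⟩} : Set (Set.Ici (ofPerm π)))
        ⟨cut π (A ∩ B), ofPerm_le_cut⟩ := by
    intro π A B
    constructor
    · rintro _ (rfl | rfl)
      · exact Subtype.mk_le_mk.2 (cut_le_cut.2 Finset.inter_subset_left)
      · exact Subtype.mk_le_mk.2 (cut_le_cut.2 Finset.inter_subset_right)
    · rintro ⟨U, hU⟩ h
      obtain ⟨C, rfl⟩ := exists_eq_cut hU
      refine Subtype.mk_le_mk.2 (cut_le_cut.2 (Finset.subset_inter ?_ ?_))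
      · exact cut_le_cut.1 (Subtype.mk_le_mk.1 (h (Set.mem_insert _ _)))
      · exact cut_le_cut.1 (Subtype.mk_le_mk.1 (h (Set.mem_insert_of_mem _ rfl)))
  have hglb : ∀ (π : Equiv.Perm (Fin (d + 1))) (A B : Finset (Fin d)),
      IsGLB ({⟨cut π A, ofPerm_le_cut⟩, ⟨cut π B, ofPerm_le_cut⟩} : Set (Set.Ici (ofPerm π)))
        ⟨cut π (A ∪ B), ofPerm_le_cut⟩ := by
    intro π A B
    constructor
    · rintro _ (rfl | rfl)
      · exact Subtype.mk_le_mk.2 (cut_le_cut.2 Finset.subset_union_left)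
      · exact Subtype.mk_le_mk.2 (cut_le_cut.2 Finset.subset_union_right)
    · rintro ⟨U, hU⟩ h
      obtain ⟨C, rfl⟩ := exists_eq_cut hU
      refine Subtype.mk_le_mk.2 (cut_le_cut.2 (Finset.union_subset ?_ ?_))
      · exact cut_le_cut.1 (Subtype.mk_le_mk.1 (h (Set.mem_insert _ _)))
      · exact cut_le_cut.1 (Subtype.mk_le_mk.1 (h (Set.mem_insert_of_mem _ rfl)))
  constructor
  · intro h π A B
    exact h π _ _ _ _ (hlub π A B) (hglb π A B)
  · rintro h π ⟨S, hS⟩ ⟨T, hT⟩ J K hJ hK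
    obtain ⟨A, rfl⟩ := exists_eq_cut hS
    obtain ⟨B, rfl⟩ := exists_eq_cut hT
    rw [hJ.unique (hlub π A B), hK.unique (hglb π A B)]
    exact h π A B

/-- A set function is submodular if its second differences are nonpositive. -/
theorem submodular_of_insert_insert {α : Type*} [DecidableEq α] {f : Finset α → ℝ}
    (h : ∀ (X : Finset α) (k l : α), k ∉ X → l ∉ X → k ≠ l →
      f X + f (insert k (insert l X)) ≤ f (insert k X) + f (insert l X)) (A B : Finset α) :
    f (A ∩ B) + f (A ∪ B) ≤ f A + f B := by
  -- The marginal value of `k` decreases when the set is enlarged by a set `Y`.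
  have marginal : ∀ (Y X : Finset α) (k : α), k ∉ X → k ∉ Y → Disjoint X Y →
      f X + f (insert k (X ∪ Y)) ≤ f (insert k X) + f (X ∪ Y) := by
    intro Y
    induction Y using Finset.induction_on with
    | empty => intro X k _ _ _; simp [add_comm]
    | insert l Y hl ih =>
      intro X k hX hY hXY
      rw [Finset.mem_insert, not_or] at hY
      rw [Finset.disjoint_insert_right] at hXY
      have h1 := ih X k hX hY.2 hXY.2
      have h2 := h (X ∪ Y) k l (by simp [hX, hY.2]) (by simp [hXY.1, hl]) hY.1
      rw [Finset.union_insert]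
      linarith
  have main : ∀ (Y X Z : Finset α), Disjoint X Y → Disjoint Y Z → Disjoint X Z →
      f X + f (X ∪ Y ∪ Z) ≤ f (X ∪ Y) + f (X ∪ Z) := by
    intro Y
    induction Y using Finset.induction_on with
    | empty => intro X Z _ _ _; simp
    | insert k Y hk ih =>
      intro X Z hXY hYZ hXZ
      rw [Finset.disjoint_insert_right] at hXY
      rw [Finset.disjoint_insert_left] at hYZ
      have h1 := ih X Z hXY.2 hYZ.2 hXZ
      have h2 := marginal Z (X ∪ Y) k (by simp [hXY.1, hk]) hYZ.1
        (Finset.disjoint_union_left.2 ⟨hXZ, hYZ.2⟩)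
      rw [Finset.union_insert, Finset.insert_union]
      linarith
  have := main (A \ B) (A ∩ B) (B \ A) (Finset.disjoint_sdiff_inter A B).symm
    (disjoint_sdiff_sdiff) (by rw [Finset.inter_comm]; exact (Finset.disjoint_sdiff_inter B A).symm)
  rwa [Finset.union_comm (A ∩ B) (A \ B), Finset.sdiff_union_inter, Finset.union_sdiff_self_eq_union,
    Finset.inter_comm A B, Finset.union_comm (B ∩ A), Finset.sdiff_union_inter,
    Finset.inter_comm B A] at this

theorem locallySubmodular_iff_diamondSubmodular {b : ProperOSP d → ℝ} :
    LocallySubmodular b ↔ DiamondSubmodular b := by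
  rw [locallySubmodular_iff]
  constructor
  · intro h X Y Y' Z hXY hXY' hYZ hYZ' hne
    obtain ⟨π, hπ⟩ := exists_ofPerm_le X
    obtain ⟨A, rfl⟩ := exists_eq_cut hπ
    obtain ⟨B, rfl⟩ := exists_eq_cut (hπ.trans hXY.le)
    obtain ⟨B', rfl⟩ := exists_eq_cut (hπ.trans hXY'.le)
    obtain ⟨C, rfl⟩ := exists_eq_cut ((hπ.trans hXY.le).trans hYZ.le)
    rw [cut_covBy_cut] at hXY hXY' hYZ hYZ'
    have hBB' : B ≠ B' := fun h => hne (by rw [h])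
    have h1 : B ∪ B' = A := WCovBy.sup_eq hXY.wcovBy hXY'.wcovBy hBB'
    have h2 : B ∩ B' = C := WCovBy.inf_eq hYZ.wcovBy hYZ'.wcovBy hBB'
    have h3 := h π B B'
    rwa [h1, h2] at h3
  · intro h π
    refine submodular_of_insert_insert fun X k l hk hl hkl => ?_
    refine h _ _ _ _ (cut_covBy_cut.2 ?_) (cut_covBy_cut.2 ?_) (cut_covBy_cut.2 ?_)
      (cut_covBy_cut.2 ?_) ?_
    · rw [Finset.insert_comm]
      exact Finset.covBy_insert (by simp [hl, hkl.symm])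
    · exact Finset.covBy_insert (by simp [hk, hkl])
    · exact Finset.covBy_insert hk
    · exact Finset.covBy_insert hl
    · intro heq
      have h1 := cut_injective heq
      have h2 : k ∈ insert l X := h1 ▸ Finset.mem_insert_self k X
      simp [hk, hkl] at h2

end Cut

/-! ### The ren condition in terms of cut sets -/

/-- The permutation `π`, followed by the exchange of the positions `i` and `i + 1`. -/
def swapAt {d : ℕ} (π : Equiv.Perm (Fin (d + 1))) (i : Fin d) : Equiv.Perm (Fin (d + 1)) :=
  π.trans (Equiv.swap i.castSucc i.succ)

/-- The cuts next to the cut `i`. -/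
def neighbors {d : ℕ} (i : Fin d) : Finset (Fin d) :=
  Finset.univ.filter fun k => (k : ℕ) + 1 = i ∨ (k : ℕ) = i + 1

section Ren

variable {d : ℕ} {π : Equiv.Perm (Fin (d + 1))} {i : Fin d}

theorem mem_block {n : ℕ} {T : OrderedSetPartition n} {j : ℕ} {x : Fin n} :
    x ∈ T.block j ↔ T.label x = j := by
  simp [block]

theorem notMem_neighbors : i ∉ neighbors i := by
  simp [neighbors]

theorem swapAt_swapAt : swapAt (swapAt π i) i = π := by
  ext x
  simp [swapAt]

theorem cut_swapAt {A : Finset (Fin d)} (hi : i ∉ A) : cut (swapAt π i) A = cut π A := by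
  have h : cutCount A i.succ = cutCount A i.castSucc := by simp [cutCount_succ, hi]
  ext x
  simp only [cut_label, swapAt, Equiv.trans_apply]
  rcases eq_or_ne (π x) i.castSucc with h1 | h1
  · rw [h1, Equiv.swap_apply_left, h]
  rcases eq_or_ne (π x) i.succ with h2 | h2
  · rw [h2, Equiv.swap_apply_right, h]
  rw [Equiv.swap_apply_of_ne_of_ne h1 h2]

theorem eq_of_cutCount_erase_eq {p q : Fin (d + 1)} (hpq : p < q)
    (h : cutCount (Finset.univ.erase i) p = cutCount (Finset.univ.erase i) q) :
    p = i.castSucc ∧ q = i.succ := by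
  have key : ∀ k : Fin d, (p : ℕ) ≤ k → (k : ℕ) < q → k = i := by
    intro k h1 h2
    by_contra hk
    exact h.not_lt ((cutCount_lt_iff _).2
      ⟨k, Finset.mem_erase.2 ⟨hk, Finset.mem_univ _⟩, Fin.le_def.2 h1, Fin.lt_def.2 h2⟩)
  have hpq' : (p : ℕ) < q := hpq
  have hq := q.isLt
  have h1 := key ⟨p, by omega⟩ le_rfl hpq'
  have h2 : ¬ (p : ℕ) + 1 < q := fun h2 => by
    have := key ⟨p + 1, by omega⟩ (by simp) h2
    rw [Fin.ext_iff] at this h1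
    simp at this h1
    omega
  rw [Fin.ext_iff] at h1
  simp only at h1
  simp only [Fin.ext_iff, Fin.val_castSucc, Fin.val_succ]
  omega

theorem isGreatest_cut_neighbors :
    IsGreatest {U | cut π (Finset.univ.erase i) ≤ U ∧
      ∃ j, U.block j = {π.symm i.castSucc, π.symm i.succ}} (cut π (neighbors i)) := by
  have hnot := notMem_neighbors (i := i)
  constructor
  · refine ⟨cut_le_cut.2 fun k hk => Finset.mem_erase.2 ⟨?_, Finset.mem_univ _⟩,
      cutCount (neighbors i) i.castSucc, ?_⟩
    · rintro rfl
      exact hnot hk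
    · ext x
      rw [mem_block, cut_label, Finset.mem_insert, Finset.mem_singleton, Equiv.eq_symm_apply,
        Equiv.eq_symm_apply]
      constructor
      · intro h
        by_contra! hne
        have hp := (π x).isLt
        simp only [ne_eq, Fin.ext_iff, Fin.val_castSucc, Fin.val_succ] at hne
        rcases lt_or_ge (π x : ℕ) i with hlt | hge
        · refine h.not_lt ((cutCount_lt_iff _).2 ⟨⟨i - 1, by omega⟩, ?_, ?_, ?_⟩)
          · simp only [neighbors, Finset.mem_filter, Finset.mem_univ, true_and]
            omega
          · rw [Fin.le_def]; simp only [Fin.val_castSucc]; omega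
          · rw [Fin.lt_def]; simp only [Fin.val_castSucc]; omega
        · refine h.symm.not_lt ((cutCount_lt_iff _).2 ⟨⟨i + 1, by omega⟩, ?_, ?_, ?_⟩)
          · simp [neighbors]
          · rw [Fin.le_def]; simp
          · rw [Fin.lt_def]; simp only [Fin.val_castSucc]; omega
      · rintro (h | h)
        · rw [h]
        · rw [h, cutCount_succ, if_neg hnot, add_zero]
  · rintro U ⟨hU, j, hj⟩
    obtain ⟨B, rfl⟩ := exists_eq_cut (ofPerm_le_cut.trans hU)
    have hblock : ∀ p : Fin (d + 1), cutCount B p = j ↔ p = i.castSucc ∨ p = i.succ := by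
      intro p
      have := Finset.ext_iff.1 hj (π.symm p)
      simpa [mem_block] using this
    rw [cut_le_cut]
    intro k hk
    by_contra hkB
    have heq : cutCount B k.succ = cutCount B k.castSucc := by simp [cutCount_succ, hkB]
    simp only [neighbors, Finset.mem_filter, Finset.mem_univ, true_and] at hk
    rcases hk with hk | hk
    · have h1 : k.succ = i.castSucc := by ext; simpa using hk
      have h2 := (hblock k.castSucc).1 (heq.symm.trans ((hblock k.succ).2 (Or.inl h1)))
      simp only [Fin.ext_iff, Fin.val_castSucc, Fin.val_succ] at h2
      omega
    · have h1 : k.castSucc = i.succ := by ext; simpa using hk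
      have h2 := (hblock k.succ).1 (heq.trans ((hblock k.castSucc).2 (Or.inr h1)))
      simp only [Fin.ext_iff, Fin.val_castSucc, Fin.val_succ] at h2
      omega

/-- Below a partition whose only block with more than one element is `{s, s'}`, a partition that
separates `s` and `s'` is determined by the order in which they appear. -/
theorem eq_of_le_of_label_lt {n : ℕ} {T X Y : OrderedSetPartition n} {s s' : Fin n}
    (hT : ∀ x y, T.label x = T.label y → x = y ∨ (x = s ∧ y = s') ∨ (x = s' ∧ y = s))
    (hX : X ≤ T) (hY : Y ≤ T) (hXs : X.label s < X.label s') (hYs : Y.label s < Y.label s') :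
    X = Y := by
  have key : ∀ {X Y : OrderedSetPartition n}, X ≤ T → Y ≤ T → X.label s < X.label s' →
      Y.label s < Y.label s' → X ≤ Y := by
    intro X Y hX hY hXs hYs x y hxy
    rcases (hX x y hxy).lt_or_eq with h | h
    · by_contra hc
      have := hY y x (by omega)
      omega
    · rcases hT x y h with rfl | ⟨rfl, rfl⟩ | ⟨rfl, rfl⟩ <;> omega
  exact le_antisymm (key hX hY hXs hYs) (key hY hX hYs hXs)

theorem exists_of_covBy_of_rank_eq_one {T T₀ : OrderedSetPartition (d + 1)} (hT : T.rank = 1)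
    (h : T₀ ⋖ T) : ∃ π i, T₀ = cut π Finset.univ ∧ T = cut π (Finset.univ.erase i) := by
  obtain ⟨π, hπ⟩ := exists_ofPerm_le T₀
  obtain ⟨B, rfl⟩ := exists_eq_cut hπ
  obtain ⟨A, rfl⟩ := exists_eq_cut (hπ.trans h.le)
  rw [rank_cut] at hT
  rw [cut_covBy_cut] at h
  have hlt := Finset.card_lt_card h.lt
  have hB := Finset.card_le_univ B
  rw [Fintype.card_fin] at hB
  have hB' : B = Finset.univ := Finset.eq_univ_of_card _ (by rw [Fintype.card_fin]; omega)
  subst hB'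
  obtain ⟨i, hi⟩ : ∃ i, i ∉ A := by
    by_contra! hc
    exact h.lt.not_ge fun x _ => hc x
  refine ⟨π, i, rfl, ?_⟩
  rw [Finset.eq_of_subset_of_card_le (s := A) (t := Finset.univ.erase i)]
  · intro x hx
    refine Finset.mem_erase.2 ⟨?_, Finset.mem_univ _⟩
    rintro rfl
    exact hi hx
  · rw [Finset.card_erase_of_mem (Finset.mem_univ _), Finset.card_univ, Fintype.card_fin]
    omega

theorem renCondition_iff {b : ProperOSP d → ℝ} : RenCondition b ↔
    ∀ π i, 2 * cutValue b π (Finset.univ.erase i) + cutValue b π (neighbors i) ≤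
      cutValue b π Finset.univ + cutValue b (swapAt π i) Finset.univ := by
  have herase : ∀ i : Fin d, Finset.univ.erase i ⋖ Finset.univ := fun i => by
    conv_rhs => rw [← Finset.insert_erase (Finset.mem_univ i)]
    exact Finset.covBy_insert (Finset.notMem_erase _ _)
  constructor
  · intro h π i
    have hlab : ∀ x, (cut π (Finset.univ : Finset (Fin d))).label x = (π x : ℕ) :=
      fun x => cutCount_univ _
    refine h (cut π (Finset.univ.erase i)) _ _ _ (π.symm i.castSucc) (π.symm i.succ) ?_ ?_ ?_
      (cut_covBy_cut.2 (herase i)) ?_ ?_ isGreatest_cut_neighbors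
    · rw [rank_cut, Finset.card_erase_of_mem (Finset.mem_univ _), Finset.card_univ,
        Fintype.card_fin]
      have := i.isLt
      omega
    · rw [ne_eq, π.symm.injective.eq_iff]
      exact Fin.castSucc_lt_succ.ne
    · simp [cutCount_succ]
    · rw [← cut_swapAt (Finset.notMem_erase i _)]
      exact cut_covBy_cut.2 (herase i)
    · intro heq
      have := congrArg (fun X => X.label (π.symm i.castSucc)) heq
      simp [cutCount_univ, swapAt] at this
  · intro h T T₀ T₀' S s s' hT hss hlab hT₀ hT₀' hne hS
    obtain ⟨π, i, rfl, rfl⟩ := exists_of_covBy_of_rank_eq_one hT hT₀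
    obtain ⟨π', i', rfl, hT'⟩ := exists_of_covBy_of_rank_eq_one hT hT₀'
    have hpair : ∀ x y, (cut π (Finset.univ.erase i)).label x =
        (cut π (Finset.univ.erase i)).label y → π x < π y → π x = i.castSucc ∧ π y = i.succ :=
      fun x y h1 h2 => eq_of_cutCount_erase_eq h2 h1
    wlog hlt : π s < π s' generalizing s s'
    · refine this s' s hss.symm hlab.symm (by rwa [Finset.pair_comm]) ?_
      exact lt_of_le_of_ne (not_lt.1 hlt) fun h => hss (π.injective h).symm
    obtain ⟨h1, h2⟩ := hpair s s' hlab hlt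
    have hs : s = π.symm i.castSucc := by rw [← h1, Equiv.symm_apply_apply]
    have hs' : s' = π.symm i.succ := by rw [← h2, Equiv.symm_apply_apply]
    have hTeq : ∀ x y, (cut π (Finset.univ.erase i)).label x =
        (cut π (Finset.univ.erase i)).label y → x = y ∨ (x = s ∧ y = s') ∨ (x = s' ∧ y = s) := by
      intro x y hxy
      rcases lt_trichotomy (π x) (π y) with h3 | h3 | h3
      · obtain ⟨h4, h5⟩ := hpair x y hxy h3
        exact Or.inr (Or.inl ⟨π.injective (h4.trans h1.symm), π.injective (h5.trans h2.symm)⟩)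
      · exact Or.inl (π.injective h3)
      · obtain ⟨h4, h5⟩ := hpair y x hxy.symm h3
        exact Or.inr (Or.inr ⟨π.injective (h5.trans h2.symm), π.injective (h4.trans h1.symm)⟩)
    have hT₀'eq : cut π' Finset.univ = cut (swapAt π i) Finset.univ := by
      refine eq_of_le_of_label_lt (s := s') (s' := s) (fun x y hxy => (hTeq x y hxy).imp_right
        Or.symm) hT₀'.le ?_ ?_ ?_
      · rw [← cut_swapAt (Finset.notMem_erase i _), cut_le_cut]
        exact Finset.subset_univ _
      · refine lt_of_le_of_ne (not_lt.1 fun hlt' => hne ?_) fun heq => hss ?_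
        · refine eq_of_le_of_label_lt hTeq hT₀.le hT₀'.le ?_ hlt'
          simpa [cutCount_univ] using hlt
        · simp only [cut_label, cutCount_univ, Fin.val_inj] at heq
          exact (π'.injective heq).symm
      · simp [cutCount_univ, swapAt, h1, h2]
    rw [hs, hs'] at hS
    rw [hS.unique isGreatest_cut_neighbors, hT₀'eq]
    exact h π i

end Ren

/-! ### The greedy algorithm for submodular functions -/

/-- The elements in the position `j` or later in the order `τ⁻¹(0), τ⁻¹(1), …`. -/
def upper {d : ℕ} (τ : Equiv.Perm (Fin d)) (j : ℕ) : Finset (Fin d) :=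
  Finset.univ.filter fun k => j ≤ (τ k : ℕ)

/-- The marginal values of the set function `f` when the elements are added in the order
`…, τ⁻¹(1), τ⁻¹(0)`. -/
def greedy {d : ℕ} (f : Finset (Fin d) → ℝ) (τ : Equiv.Perm (Fin d)) (k : Fin d) : ℝ :=
  f (upper τ (τ k)) - f (upper τ (τ k + 1))

/-- The sequence `0, g (τ⁻¹(0)), g (τ⁻¹(1)), …`. -/
def step {d : ℕ} {M : Type*} [AddCommGroup M] (τ : Equiv.Perm (Fin d)) (g : Fin d → M) : ℕ → M
  | 0 => 0
  | m + 1 => if h : m < d then g (τ.symm ⟨m, h⟩) else 0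

/-- The increments of the sequence `0, g (τ⁻¹(0)), g (τ⁻¹(1)), …`. -/
def jump {d : ℕ} {M : Type*} [AddCommGroup M] (τ : Equiv.Perm (Fin d)) (g : Fin d → M)
    (j : Fin d) : M := step τ g (j + 1) - step τ g j

section Greedy

variable {d : ℕ} {f : Finset (Fin d) → ℝ} {τ τ' : Equiv.Perm (Fin d)}

theorem mem_upper {j : ℕ} {k : Fin d} : k ∈ upper τ j ↔ j ≤ (τ k : ℕ) := by
  simp [upper]

theorem upper_zero : upper τ 0 = Finset.univ := by
  ext k; simp [mem_upper]

theorem upper_self : upper τ d = ∅ := by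
  ext k; simp [mem_upper]

theorem upper_nonempty (τ : Equiv.Perm (Fin d)) (j : Fin d) : (upper τ j).Nonempty :=
  ⟨τ.symm j, by simp [mem_upper]⟩

theorem upper_eq_insert (k : Fin d) : upper τ (τ k) = insert k (upper τ (τ k + 1)) := by
  ext l
  rw [Finset.mem_insert, mem_upper, mem_upper, ← τ.injective.eq_iff, Fin.ext_iff]
  omega

theorem notMem_upper_succ (k : Fin d) : k ∉ upper τ (τ k + 1) := by
  simp [mem_upper]

theorem upper_one_of_apply_eq_zero {i : Fin d} (hi : (τ i : ℕ) = 0) :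
    upper τ 1 = Finset.univ.erase i := by
  ext l
  rw [mem_upper, Finset.mem_erase, ne_eq, ← τ.injective.eq_iff, Fin.ext_iff]
  simp only [Finset.mem_univ, and_true]
  omega

/-- Backward induction along the sets `upper τ j`. -/
theorem upper_induction {p : Finset (Fin d) → Prop} (h0 : p ∅)
    (hs : ∀ k, p (upper τ (τ k + 1)) → p (upper τ (τ k))) {j : ℕ} (hj : j ≤ d) :
    p (upper τ j) := by
  induction hj using Nat.decreasingInduction with
  | self => rwa [upper_self]
  | of_succ j hj ih =>
    have := hs (τ.symm ⟨j, hj⟩)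
    simp only [Equiv.apply_symm_apply] at this
    exact this ih

theorem sum_greedy_upper (hf : f ∅ = 0) {j : ℕ} (hj : j ≤ d) :
    ∑ k ∈ upper τ j, greedy f τ k = f (upper τ j) := by
  refine upper_induction (p := fun A => ∑ k ∈ A, greedy f τ k = f A) (by simp [hf]) ?_ hj
  intro k ih
  have h := upper_eq_insert (τ := τ) k
  conv_lhs => rw [h, Finset.sum_insert (notMem_upper_succ k), ih, greedy]
  ring

/-- The greedy marginals of a submodular function lie in its base polytope. -/
theorem sum_greedy_le (hf : f ∅ = 0) (hsub : ∀ A B, f (A ∩ B) + f (A ∪ B) ≤ f A + f B)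
    (B : Finset (Fin d)) : ∑ k ∈ B, greedy f τ k ≤ f B := by
  have key : ∑ k ∈ B ∩ upper τ 0, greedy f τ k ≤ f (B ∩ upper τ 0) := by
    refine upper_induction (p := fun A => ∑ k ∈ B ∩ A, greedy f τ k ≤ f (B ∩ A))
      (by simp [hf]) ?_ (Nat.zero_le d)
    intro k ih
    have h := upper_eq_insert (τ := τ) k
    by_cases hk : k ∈ B
    · have h1 : B ∩ upper τ (τ k) = insert k (B ∩ upper τ (τ k + 1)) := by
        rw [h, Finset.inter_insert_of_mem hk]
      have h2 := hsub (upper τ (τ k + 1)) (B ∩ upper τ (τ k))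
      have h3 : upper τ (τ k + 1) ∩ (B ∩ upper τ (τ k)) = B ∩ upper τ (τ k + 1) := by
        rw [h]
        ext l
        simp only [Finset.mem_inter, Finset.mem_insert]
        tauto
      have h4 : upper τ (τ k + 1) ∪ (B ∩ upper τ (τ k)) = upper τ (τ k) := by
        rw [h]
        ext l
        simp only [Finset.mem_union, Finset.mem_inter, Finset.mem_insert]
        constructor
        · tauto
        · rintro (rfl | hl) <;> tauto
      rw [h3, h4] at h2
      have h5 : ∑ l ∈ B ∩ upper τ (τ k), greedy f τ l =
          greedy f τ k + ∑ l ∈ B ∩ upper τ (τ k + 1), greedy f τ l := by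
        rw [h1, Finset.sum_insert fun hm =>
          notMem_upper_succ (τ := τ) k (Finset.mem_inter.1 hm).2]
      rw [h5, greedy]
      linarith
    · rwa [h, Finset.inter_insert_of_notMem hk]
  rwa [upper_zero, Finset.inter_univ] at key

theorem step_succ {M : Type*} [AddCommGroup M] (g : Fin d → M) (j : Fin d) :
    step τ g (j + 1) = g (τ.symm j) := by
  simp [step]

theorem jump_of_val_eq_zero {M : Type*} [AddCommGroup M] (g : Fin d → M) {j : Fin d}
    (hj : (j : ℕ) = 0) : jump τ g j = g (τ.symm j) := by
  rw [jump, step_succ, hj, step, sub_zero]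

theorem jump_of_val_eq_succ {M : Type*} [AddCommGroup M] (g : Fin d → M) {i j : Fin d}
    (hj : (j : ℕ) = i + 1) : jump τ g j = g (τ.symm j) - g (τ.symm i) := by
  rw [jump, step_succ, hj, step_succ]

theorem map_jump {M N : Type*} [AddCommGroup M] [AddCommGroup N] [Module ℝ M] [Module ℝ N]
    (w : M →ₗ[ℝ] N) (g : Fin d → M) (j : Fin d) :
    w (jump τ g j) = jump τ (fun k => w (g k)) j := by
  have : ∀ m, w (step τ g m) = step τ (fun k => w (g k)) m := by
    rintro (_ | m)
    · simp [step]
    · simp only [step]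
      split_ifs <;> simp
  rw [jump, jump, map_sub, this, this]

theorem sum_jump (g : Fin d → ℝ) (t : Fin d) :
    (∑ j : Fin d, if (j : ℕ) ≤ t then jump τ g j else 0) = g (τ.symm t) := by
  simp only [jump]
  rw [Fin.sum_univ_eq_sum_range (fun j => if j ≤ t then step τ g (j + 1) - step τ g j else 0) d,
    ← Finset.sum_filter]
  have : (Finset.range d).filter (fun j => j ≤ (t : ℕ)) = Finset.range (t + 1) := by
    ext j
    simp only [Finset.mem_filter, Finset.mem_range]
    have := t.isLt
    omega
  rw [this, Finset.sum_range_sub, step_succ, step, sub_zero]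

theorem sum_jump_mul_indicator (g : Fin d → ℝ) (k : Fin d) :
    (∑ j : Fin d, jump τ g j * if k ∈ upper τ j then 1 else 0) = g k := by
  rw [← τ.symm_apply_apply k, ← sum_jump (τ := τ) g (τ k)]
  simp [mem_upper]

/-- Summation by parts: a linear form in terms of its values on the sets `upper τ j`. -/
theorem sum_mul_eq_sum_jump_mul (m g : Fin d → ℝ) :
    ∑ k, m k * g k = ∑ j : Fin d, jump τ g j * ∑ k ∈ upper τ j, m k := by
  simp_rw [Finset.mul_sum, upper, Finset.sum_filter]
  rw [Finset.sum_comm]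
  refine Finset.sum_congr rfl fun k _ => ?_
  rw [← sum_jump_mul_indicator (τ := τ) g k, Finset.mul_sum]
  refine Finset.sum_congr rfl fun j _ => ?_
  simp only [mem_upper]
  split_ifs <;> ring

theorem forall_jump_nonneg_iff {g : Fin d → ℝ} :
    (∀ j, 0 ≤ jump τ g j) ↔ (∀ k, 0 ≤ g k) ∧ Monotone fun j => g (τ.symm j) := by
  constructor
  · intro h
    have hmono : ∀ m n, m ≤ n → n ≤ d → step τ g m ≤ step τ g n := by
      intro m n hmn
      induction n, hmn using Nat.le_induction with
      | base => exact fun _ => le_rfl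
      | succ n hmn ih =>
        intro hn
        exact (ih (by omega)).trans (sub_nonneg.1 (h ⟨n, hn⟩))
    refine ⟨fun k => ?_, fun p q hpq => ?_⟩
    · have h1 := hmono 0 (τ k + 1) (Nat.zero_le _) (τ k).isLt
      rwa [step_succ, Equiv.symm_apply_apply] at h1
    · have h1 := hmono (p + 1) (q + 1) (Nat.succ_le_succ hpq) q.isLt
      rwa [step_succ, step_succ] at h1
  · rintro ⟨h0, hmono⟩ j
    rcases Nat.eq_zero_or_eq_succ_pred (j : ℕ) with hj | hj
    · rw [jump_of_val_eq_zero g hj]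
      exact h0 _
    · have hlt : (j : ℕ).pred < d := by have := j.isLt; omega
      rw [jump_of_val_eq_succ g (i := ⟨_, hlt⟩) hj, sub_nonneg]
      exact hmono (Fin.le_def.2 (by simp))

/-- The greedy algorithm: among all orders, one that sorts `g` maximizes the linear form with the
greedy marginals at `g`. -/
theorem sum_greedy_mul_le (hf : f ∅ = 0) (hsub : ∀ A B, f (A ∩ B) + f (A ∪ B) ≤ f A + f B)
    {g : Fin d → ℝ} (hτ' : Monotone fun j => g (τ'.symm j)) :
    ∑ k, greedy f τ k * g k ≤ ∑ k, greedy f τ' k * g k := by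
  rw [sum_mul_eq_sum_jump_mul (τ := τ'), sum_mul_eq_sum_jump_mul (τ := τ') (greedy f τ')]
  refine Finset.sum_le_sum fun j _ => ?_
  rw [sum_greedy_upper hf j.isLt.le]
  rcases Nat.eq_zero_or_eq_succ_pred (j : ℕ) with hj | hj
  · -- On the whole ground set all greedy marginals have the same sum.
    have h := sum_greedy_upper (τ := τ) hf (Nat.zero_le d)
    rw [upper_zero] at h
    rw [hj, upper_zero, h]
  · refine mul_le_mul_of_nonneg_left (sum_greedy_le hf hsub _) ?_
    have hlt : (j : ℕ).pred < d := by have := j.isLt; omega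
    rw [jump_of_val_eq_succ g (i := ⟨_, hlt⟩) hj, sub_nonneg]
    exact hτ' (Fin.le_def.2 (by simp))

end Greedy

/-! ### From local to global inequalities -/

/-- The first differences of `x` in the order `π⁻¹(0), π⁻¹(1), …`. -/
def gap {d : ℕ} (π : Equiv.Perm (Fin (d + 1))) (x : Fin (d + 1) → ℝ) (k : Fin d) : ℝ :=
  x (π.symm k.succ) - x (π.symm k.castSucc)

/-- The value at `x` of the linear functional that agrees on the cone `σ(π, τ)` with the piecewise
linear function given by `b`. -/
noncomputable def linearPiece {d : ℕ} (b : ProperOSP d → ℝ) (π : Equiv.Perm (Fin (d + 1)))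
    (τ : Equiv.Perm (Fin d)) (x : Fin (d + 1) → ℝ) : ℝ :=
  ∑ k, greedy (cutValue b π) τ k * gap π x k

section LocalToGlobal

variable {d : ℕ} {b : ProperOSP d → ℝ} {π π' : Equiv.Perm (Fin (d + 1))}
  {τ τ' : Equiv.Perm (Fin d)} {x : Fin (d + 1) → ℝ} {i : Fin d}

theorem monotone_iff_gap_nonneg : (Monotone fun p => x (π.symm p)) ↔ ∀ k, 0 ≤ gap π x k := by
  rw [Fin.monotone_iff_le_succ]
  simp [gap]

theorem gap_add_smul (y : Fin (d + 1) → ℝ) (c : ℝ) (k : Fin d) :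
    gap π (x + c • y) k = gap π x k + c * gap π y k := by
  simp only [gap, Pi.add_apply, Pi.smul_apply, smul_eq_mul]
  ring

/-- The Cartan matrix of type `A` describes the change of the first differences. -/
theorem gap_swapAt (k : Fin d) : gap (swapAt π i) x k =
    if k = i then -gap π x i else gap π x k + if k ∈ neighbors i then gap π x i else 0 := by
  have hsymm : ∀ p, (swapAt π i).symm p = π.symm (Equiv.swap i.castSucc i.succ p) := by
    intro p
    simp [swapAt]
  simp only [gap, hsymm]
  split_ifs with h1 h2
  · rw [h1, Equiv.swap_apply_left, Equiv.swap_apply_right]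
    ring
  · simp only [neighbors, Finset.mem_filter, Finset.mem_univ, true_and] at h2
    rcases h2 with h2 | h2
    · rw [show k.succ = i.castSucc by ext; simpa using h2, Equiv.swap_apply_left,
        Equiv.swap_apply_of_ne_of_ne (a := i.castSucc) (x := k.castSucc)]
      · ring
      · simpa using h1
      · simp only [ne_eq, Fin.ext_iff, Fin.val_castSucc, Fin.val_succ]
        omega
    · rw [show k.castSucc = i.succ by ext; simpa using h2, Equiv.swap_apply_right,
        Equiv.swap_apply_of_ne_of_ne (a := i.castSucc) (x := k.succ)]
      · ring
      · simp only [ne_eq, Fin.ext_iff, Fin.val_castSucc, Fin.val_succ]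
        omega
      · simpa using h1
  · simp only [neighbors, Finset.mem_filter, Finset.mem_univ, true_and] at h2
    rw [Fin.ext_iff] at h1
    rw [Equiv.swap_apply_of_ne_of_ne, Equiv.swap_apply_of_ne_of_ne, add_zero]
    all_goals
      simp only [ne_eq, Fin.ext_iff, Fin.val_castSucc, Fin.val_succ]
      omega

/-- Crossing the wall between two chambers of the braid arrangement towards `x` does not decrease
the value at `x`.  The neighbouring cut set need not belong to the flag of `τ`, and so local
submodularity is needed besides the ren condition. -/
theorem linearPiece_le_linearPiece_swapAt (hsub : LocallySubmodular b) (hren : RenCondition b)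
    (hi : (τ i : ℕ) = 0) (hx : gap π x i ≤ 0) :
    linearPiece b π τ x ≤ linearPiece b (swapAt π i) τ x := by
  have hcut : ∀ A : Finset (Fin d), i ∉ A → cutValue b (swapAt π i) A = cutValue b π A :=
    fun A hA => by rw [cutValue, cutValue, cut_swapAt hA]
  have hgreedy : ∀ k ∈ Finset.univ.erase i,
      greedy (cutValue b (swapAt π i)) τ k = greedy (cutValue b π) τ k := by
    intro k hk
    have hk' : (τ k : ℕ) ≠ 0 := fun h => (Finset.mem_erase.1 hk).1
      (τ.injective (Fin.ext (h.trans hi.symm)))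
    rw [greedy, greedy, hcut, hcut]
    · simp [mem_upper, hi]
    · rw [mem_upper]
      omega
  have hgreedy_i : ∀ ρ : Equiv.Perm (Fin (d + 1)), greedy (cutValue b ρ) τ i =
      cutValue b ρ Finset.univ - cutValue b ρ (Finset.univ.erase i) := by
    intro ρ
    rw [greedy, hi, upper_zero, zero_add, upper_one_of_apply_eq_zero hi]
  have hsum : ∑ k ∈ Finset.univ.erase i,
      greedy (cutValue b (swapAt π i)) τ k * gap (swapAt π i) x k =
      ∑ k ∈ Finset.univ.erase i, greedy (cutValue b π) τ k * gap π x k +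
        (∑ k ∈ neighbors i, greedy (cutValue b π) τ k) * gap π x i := by
    have hfilter : neighbors i = (Finset.univ.erase i).filter (· ∈ neighbors i) := by
      ext k
      simp only [Finset.mem_filter, Finset.mem_erase, Finset.mem_univ, and_true]
      refine ⟨fun h => ⟨?_, h⟩, fun h => h.2⟩
      rintro rfl
      exact notMem_neighbors h
    conv_rhs => rw [hfilter, Finset.sum_mul, Finset.sum_filter, ← Finset.sum_add_distrib]
    refine Finset.sum_congr rfl fun k hk => ?_
    rw [hgreedy k hk, gap_swapAt, if_neg (Finset.mem_erase.1 hk).1]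
    split_ifs <;> ring
  have h1 := (renCondition_iff.1 hren) π i
  have h2 := sum_greedy_le (τ := τ) (cutValue_empty b) (locallySubmodular_iff.1 hsub π)
    (neighbors i)
  have h3 := hcut (Finset.univ.erase i) (Finset.notMem_erase _ _)
  rw [linearPiece, linearPiece, ← Finset.add_sum_erase _ _ (Finset.mem_univ i),
    ← Finset.add_sum_erase Finset.univ (fun k => _ * gap (swapAt π i) x k) (Finset.mem_univ i),
    hsum, hgreedy_i, hgreedy_i, h3, gap_swapAt, if_pos rfl]
  nlinarith

theorem linearPiece_le_of_monotone_gap (hsub : LocallySubmodular b)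
    (hτ' : Monotone fun j => gap π x (τ'.symm j)) :
    linearPiece b π τ x ≤ linearPiece b π τ' x :=
  sum_greedy_mul_le (cutValue_empty b) (locallySubmodular_iff.1 hsub π) hτ'

theorem sum_mul_swapAt : ∑ p : Fin (d + 1), (p : ℝ) * x ((swapAt π i).symm p) =
    ∑ p : Fin (d + 1), (p : ℝ) * x (π.symm p) - gap π x i := by
  have h1 : ∑ p : Fin (d + 1), (p : ℝ) * x ((swapAt π i).symm p) =
      ∑ p : Fin (d + 1), (Equiv.swap i.castSucc i.succ p : ℝ) * x (π.symm p) := by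
    rw [← Equiv.sum_comp (Equiv.swap i.castSucc i.succ)]
    simp [swapAt]
  rw [h1, eq_sub_iff_add_eq', ← eq_sub_iff_add_eq, ← Finset.sum_sub_distrib,
    Fintype.sum_eq_add i.castSucc i.succ Fin.castSucc_lt_succ.ne]
  · simp [gap]
    ring
  · intro p hp
    rw [Equiv.swap_apply_of_ne_of_ne hp.1 hp.2, sub_self]

theorem exists_monotone_comp_symm {n : ℕ} (g : Fin n → ℝ) :
    ∃ τ : Equiv.Perm (Fin n), Monotone fun j => g (τ.symm j) :=
  ⟨(Tuple.sort g).symm, Tuple.monotone_sort g⟩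

/-- For `x` in the interior of a chamber of the braid arrangement, the largest linear piece at `x` is
the one of a cone that contains `x`. -/
theorem linearPiece_le_of_strictMono (hsub : LocallySubmodular b) (hren : RenCondition b)
    (hπ' : StrictMono fun p => x (π'.symm p)) (hτ' : Monotone fun j => gap π' x (τ'.symm j)) :
    linearPiece b π τ x ≤ linearPiece b π' τ' x := by
  -- Walk from chamber to chamber towards `x`; the walk ends because `∑ p * x (π⁻¹ p)` increases.
  obtain ⟨ρ, ⟨τ₁, h₁⟩, hmax⟩ := Set.exists_max_image
    {ρ | ∃ τ₁, linearPiece b π τ x ≤ linearPiece b ρ τ₁ x}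
    (fun ρ : Equiv.Perm (Fin (d + 1)) => ∑ p : Fin (d + 1), (p : ℝ) * x (ρ.symm p))
    (Set.toFinite _) ⟨π, τ, le_rfl⟩
  obtain ⟨τ₂, h₂⟩ := exists_monotone_comp_symm (gap ρ x)
  have h₃ := h₁.trans (linearPiece_le_of_monotone_gap (τ := τ₁) hsub h₂)
  by_cases hgap : ∀ k, 0 ≤ gap ρ x k
  · have hmono := monotone_iff_gap_nonneg.2 hgap
    have heq : x ∘ ρ.symm = x ∘ π'.symm := Tuple.unique_monotone hmono hπ'.monotone
    have hinj : Function.Injective x := by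
      have h : Function.Injective (x ∘ π'.symm) := hπ'.injective
      rwa [Equiv.injective_comp] at h
    have hρ : ρ = π' := by
      have h : ρ.symm = π'.symm := Equiv.ext fun p => hinj (congrFun heq p)
      rw [← Equiv.symm_symm ρ, h, Equiv.symm_symm]
    subst hρ
    exact h₃.trans (linearPiece_le_of_monotone_gap hsub hτ')
  · push Not at hgap
    obtain ⟨k, hk⟩ := hgap
    set i := τ₂.symm ⟨0, Fin.pos k⟩ with hi
    have hik : gap ρ x i ≤ gap ρ x k := by
      have := h₂ (show (⟨0, Fin.pos k⟩ : Fin d) ≤ τ₂ k from Fin.le_def.2 (Nat.zero_le _))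
      simpa using this
    have h₄ := linearPiece_le_linearPiece_swapAt (τ := τ₂) hsub hren (by simp [hi])
      (hik.trans hk.le)
    have h₅ := hmax (swapAt ρ i) ⟨τ₂, h₃.trans h₄⟩
    rw [sum_mul_swapAt] at h₅
    linarith

theorem linearPiece_add_smul (y : Fin (d + 1) → ℝ) (c : ℝ) :
    linearPiece b π τ (x + c • y) = linearPiece b π τ x + c * linearPiece b π τ y := by
  simp only [linearPiece, gap_add_smul, Finset.mul_sum, ← Finset.sum_add_distrib]
  refine Finset.sum_congr rfl fun k _ => ?_
  ring

/-- Local submodularity and the ren condition imply that the piecewise linear function given by `b`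
is the maximum of its linear pieces. -/
theorem linearPiece_le_linearPiece (hsub : LocallySubmodular b) (hren : RenCondition b)
    (hπ' : Monotone fun p => x (π'.symm p)) (hτ' : Monotone fun j => gap π' x (τ'.symm j)) :
    linearPiece b π τ x ≤ linearPiece b π' τ' x := by
  -- The direction `y` points into the chamber of `π'` and changes all gaps by the same amount.
  let y : Fin (d + 1) → ℝ := fun a => (π' a : ℕ)
  have hy : ∀ k, gap π' y k = 1 := fun k => by simp [gap, y]
  have key : ∀ ε : ℝ, 0 < ε → linearPiece b π τ x + ε * linearPiece b π τ y ≤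
      linearPiece b π' τ' x + ε * linearPiece b π' τ' y := by
    intro ε hε
    rw [← linearPiece_add_smul, ← linearPiece_add_smul]
    refine linearPiece_le_of_strictMono hsub hren ?_ ?_
    · intro p q hpq
      have h1 := hπ' hpq.le
      have h2 : ((p : ℕ) : ℝ) < (q : ℕ) := by exact_mod_cast hpq
      simp only [Pi.add_apply, Pi.smul_apply, smul_eq_mul, y, Equiv.apply_symm_apply]
      exact add_lt_add_of_le_of_lt h1 (mul_lt_mul_of_pos_left h2 hε)
    · intro p q hpq
      simp only [gap_add_smul, hy]
      exact add_le_add (hτ' hpq) le_rfl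
  have hcont : ∀ c c' : ℝ, Filter.Tendsto (fun ε : ℝ => c + ε * c')
      (nhdsWithin 0 (Set.Ioi 0)) (nhds c) := by
    intro c c'
    have h : Continuous fun ε : ℝ => c + ε * c' := by fun_prop
    have h0 := h.tendsto 0
    rw [zero_mul, add_zero] at h0
    exact h0.mono_left nhdsWithin_le_nhds
  refine le_of_tendsto_of_tendsto (hcont _ (linearPiece b π τ y))
    (hcont _ (linearPiece b π' τ' y)) ?_
  filter_upwards [self_mem_nhdsWithin] with ε hε
  exact key ε hε

end LocalToGlobal

/-! ### The nested Braid fan as a complete simplicial fan -/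

section Dual

variable {d : ℕ} {π : Equiv.Perm (Fin (d + 1))} {x z : Fin (d + 1) → ℝ}

theorem toDual_apply (x : Fin (d + 1) → ℝ) (y : hyperplane d) :
    toDual d x y = ∑ i, x i * (y : Fin (d + 1) → ℝ) i := rfl

theorem toDual_surjective (d : ℕ) : Function.Surjective (toDual d) := by
  intro w
  obtain ⟨g, hg⟩ := LinearMap.exists_extend w
  refine ⟨fun i => g fun j => if i = j then 1 else 0, LinearMap.ext fun y => ?_⟩
  rw [← hg, toDual_apply, LinearMap.comp_apply, LinearMap.pi_apply_eq_sum_univ g]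
  simp [mul_comm]

/-- The vector `f^π_k = e_{π⁻¹(k+1)} - e_{π⁻¹(k)}`, as an element of `V_d`. -/
def gapVec (π : Equiv.Perm (Fin (d + 1))) (k : Fin d) : hyperplane d :=
  ⟨Pi.single (π.symm k.succ) 1 - Pi.single (π.symm k.castSucc) 1, by
    change ∑ i, _ = _
    simp [Finset.sum_sub_distrib]⟩

theorem toDual_gapVec (k : Fin d) : toDual d x (gapVec π k) = gap π x k := by
  simp [toDual_apply, gapVec, gap, mul_sub, Finset.sum_sub_distrib, Pi.single_apply]

theorem sub_eq_of_gap_eq (h : ∀ k, gap π x k = gap π z k) (p : Fin (d + 1)) :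
    x (π.symm p) - x (π.symm 0) = z (π.symm p) - z (π.symm 0) := by
  induction p using Fin.induction with
  | zero => simp
  | succ k ih =>
    have := h k
    simp only [gap] at this
    linarith

theorem toDual_eq_of_gap_eq (h : ∀ k, gap π x k = gap π z k) : toDual d x = toDual d z := by
  refine LinearMap.ext fun y => ?_
  have hx : ∀ i, x i = z i + (x (π.symm 0) - z (π.symm 0)) := by
    intro i
    have := sub_eq_of_gap_eq h (π i)
    rw [Equiv.symm_apply_apply] at this
    linarith
  have hy : ∑ i, (y : Fin (d + 1) → ℝ) i = 0 := y.2
  rw [toDual_apply, toDual_apply, Finset.sum_congr rfl fun i _ => by rw [hx i, add_mul],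
    Finset.sum_add_distrib, ← Finset.mul_sum, hy, mul_zero, add_zero]

theorem gap_cut_label (A : Finset (Fin d)) (k : Fin d) :
    gap π (fun a => ((cut π A).label a : ℝ) + 1) k = if k ∈ A then 1 else 0 := by
  simp only [gap, cut_label, Equiv.apply_symm_apply, cutCount_succ]
  push_cast
  ring

end Dual

section Flags

variable {d : ℕ}

theorem jump_indicator_upper {τ : Equiv.Perm (Fin d)} (j k : Fin d) :
    jump τ (fun l => if l ∈ upper τ j then (1 : ℝ) else 0) k = if j = k then 1 else 0 := by
  rcases Nat.eq_zero_or_eq_succ_pred (k : ℕ) with hk | hk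
  · rw [jump_of_val_eq_zero _ hk]
    simp only [mem_upper, Equiv.apply_symm_apply, Fin.ext_iff, hk, Nat.le_zero]
  · have hlt : (k : ℕ).pred < d := by have := k.isLt; omega
    rw [jump_of_val_eq_succ _ (i := ⟨_, hlt⟩) hk]
    simp only [mem_upper, Equiv.apply_symm_apply, Fin.ext_iff]
    split_ifs <;> first | omega | norm_num

/-- An upper set for the order given by `τ` is one of the sets of the flag of `τ`. -/
theorem exists_eq_upper {τ : Equiv.Perm (Fin d)} {A : Finset (Fin d)}
    (h : ∀ k ∈ A, ∀ l, τ k ≤ τ l → l ∈ A) :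
    A = ∅ ∨ ∃ j : Fin d, A = upper τ j := by
  rcases A.eq_empty_or_nonempty with rfl | hA
  · exact Or.inl rfl
  · obtain ⟨k, hk, hmin⟩ := Finset.exists_min_image A τ hA
    refine Or.inr ⟨τ k, ?_⟩
    ext l
    rw [mem_upper]
    exact ⟨fun hl => hmin l hl, fun hl => h k hk l hl⟩

/-- Two nested sets belong to a common flag. -/
theorem exists_perm_upper {A B : Finset (Fin d)} (hBA : B ⊆ A) :
    ∃ τ : Equiv.Perm (Fin d), (A = ∅ ∨ ∃ j : Fin d, A = upper τ j) ∧
      (B = ∅ ∨ ∃ j : Fin d, B = upper τ j) := by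
  obtain ⟨τ, hτ⟩ := exists_monotone_comp_symm
    (fun k => (if k ∈ A then (1 : ℝ) else 0) + if k ∈ B then 1 else 0)
  have hle : ∀ k l, τ k ≤ τ l → ((if k ∈ A then (1 : ℝ) else 0) + if k ∈ B then 1 else 0) ≤
      (if l ∈ A then (1 : ℝ) else 0) + if l ∈ B then 1 else 0 := by
    intro k l hkl
    have := hτ hkl
    simpa using this
  refine ⟨τ, exists_eq_upper fun k hk l hkl => ?_, exists_eq_upper fun k hk l hkl => ?_⟩
  · have h1 := hle k l hkl
    by_contra hl
    rw [if_pos hk, if_neg hl, if_neg fun h => hl (hBA h)] at h1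
    split_ifs at h1 <;> norm_num at h1
  · have h1 := hle k l hkl
    by_contra hl
    rw [if_pos hk, if_pos (hBA hk), if_neg hl] at h1
    split_ifs at h1 <;> norm_num at h1

theorem sum_greedy_of_upper {τ : Equiv.Perm (Fin d)} {f : Finset (Fin d) → ℝ} (hf : f ∅ = 0)
    {A : Finset (Fin d)} (hA : A = ∅ ∨ ∃ j : Fin d, A = upper τ j) :
    ∑ k ∈ A, greedy f τ k = f A := by
  rcases hA with rfl | ⟨j, rfl⟩
  · simp [hf]
  · exact sum_greedy_upper hf j.isLt.le

end Flags

/-- The nested Braid fan.  The cone `σ(π, τ)` is generated by the rays of the flag of cut sets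
`upper τ j`, and the dual basis consists of the increments of the gap vectors in the order `τ`. -/
def nestedFan (d : ℕ) : CompleteSimplicialFan (hyperplane d) (ProperOSP d)
    (Equiv.Perm (Fin (d + 1)) × Equiv.Perm (Fin d)) (Fin d) where
  ray := rayVector d
  gen σ j := ⟨cut σ.1 (upper σ.2 j), cut_ne_top (upper_nonempty _ _)⟩
  coord σ j := jump σ.2 (gapVec σ.1) j
  ray_coord σ j k := by
    rw [rayVector, map_jump]
    simp only [toDual_gapVec, gap_cut_label]
    exact jump_indicator_upper j k
  expand σ w := by
    obtain ⟨x, rfl⟩ := toDual_surjective d w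
    simp only [rayVector, map_jump, toDual_gapVec, ← map_smul, ← map_sum]
    refine toDual_eq_of_gap_eq (π := σ.1) fun k => ?_
    conv_lhs => rw [← sum_jump_mul_indicator (τ := σ.2) (gap σ.1 x) k]
    generalize gap σ.1 x = g
    simp only [← gap_cut_label (π := σ.1)]
    simp only [gap, Finset.sum_apply, Pi.smul_apply, smul_eq_mul, mul_sub, Finset.sum_sub_distrib]
  complete w := by
    obtain ⟨x, rfl⟩ := toDual_surjective d w
    obtain ⟨π, hπ⟩ := exists_monotone_comp_symm x
    obtain ⟨τ, hτ⟩ := exists_monotone_comp_symm (gap π x)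
    refine ⟨(π, τ), ?_⟩
    simp only [map_jump, toDual_gapVec]
    exact forall_jump_nonneg_iff.2 ⟨monotone_iff_gap_nonneg.1 hπ, hτ⟩
  exists_gen T := by
    obtain ⟨π, hπ⟩ := exists_ofPerm_le T.1
    obtain ⟨A, hA⟩ := exists_eq_cut hπ
    obtain ⟨τ, rfl | ⟨j, hj⟩, -⟩ := exists_perm_upper (Finset.Subset.refl A)
    · exact absurd (hA.trans cut_empty) T.2
    · exact ⟨(π, τ), j, Subtype.ext (by rw [hA, hj])⟩
  ray_injective T T' c hc h := by
    simp only [rayVector, ← map_smul] at h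
    have hgap : ∀ k, gap (Equiv.refl _) (fun a => (T'.1.label a : ℝ) + 1) k =
        gap (Equiv.refl _) (c • fun a => (T.1.label a : ℝ) + 1) k := fun k => by
      rw [← toDual_gapVec, h, toDual_gapVec]
    have hlab : ∀ a, (T'.1.label a : ℝ) - T'.1.label 0 =
        c * ((T.1.label a : ℝ) - T.1.label 0) := by
      intro a
      have := sub_eq_of_gap_eq hgap a
      simp only [Equiv.refl_symm, Equiv.refl_apply, Pi.smul_apply, smul_eq_mul] at this
      linarith
    refine Subtype.ext (le_antisymm (fun a a' haa' => ?_) fun a a' haa' => ?_)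
    · have h1 : (T'.1.label a : ℝ) ≤ T'.1.label a' := by exact_mod_cast haa'
      have h2 := hlab a
      have h3 := hlab a'
      have h4 : c * (T.1.label a : ℝ) ≤ c * T.1.label a' := by linarith
      exact_mod_cast le_of_mul_le_mul_left h4 hc
    · have h1 : (T.1.label a : ℝ) ≤ T.1.label a' := by exact_mod_cast haa'
      have h2 := hlab a
      have h3 := hlab a'
      have h4 := mul_le_mul_of_nonneg_left h1 hc.le
      have h5 : (T'.1.label a : ℝ) ≤ T'.1.label a' := by linarith
      exact_mod_cast h5

section NestedFan

variable {d : ℕ} {π : Equiv.Perm (Fin (d + 1))} {τ : Equiv.Perm (Fin d)}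

theorem toDual_mem_cone_iff {x : Fin (d + 1) → ℝ} : toDual d x ∈ (nestedFan d).cone (π, τ) ↔
    (Monotone fun p => x (π.symm p)) ∧ Monotone fun j => gap π x (τ.symm j) := by
  rw [monotone_iff_gap_nonneg, ← forall_jump_nonneg_iff]
  refine forall_congr' fun j => ?_
  change 0 ≤ toDual d x (jump τ (gapVec π) j) ↔ _
  rw [map_jump]
  simp only [toDual_gapVec]

theorem cone_nestedFan : (nestedFan d).cone (π, τ) = nestedCone d π τ := by
  ext w
  constructor
  · intro hw
    obtain ⟨x, rfl⟩ := toDual_surjective d w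
    exact ⟨x, toDual_mem_cone_iff.1 hw, rfl⟩
  · rintro ⟨x, hx, rfl⟩
    exact toDual_mem_cone_iff.2 hx

theorem nestedBraidFan_eq :
    nestedBraidFan d = {F | ∃ σ, IsFace ((nestedFan d).cone σ) F} := by
  ext F
  simp only [nestedBraidFan, Set.mem_ofPred_eq, Prod.exists, cone_nestedFan]

theorem toDual_point (b : ProperOSP d → ℝ) (x : Fin (d + 1) → ℝ) :
    toDual d x ((nestedFan d).point b (π, τ)) = linearPiece b π τ x := by
  rw [CompleteSimplicialFan.apply_point, linearPiece,
    sum_mul_eq_sum_jump_mul (τ := τ) (greedy (cutValue b π) τ)]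
  refine Finset.sum_congr rfl fun j _ => ?_
  rw [sum_greedy_upper (cutValue_empty b) j.isLt.le, cutValue_of_nonempty b (upper_nonempty τ j)]
  change toDual d x (jump τ (gapVec π) j) * _ = _
  rw [map_jump]
  simp only [toDual_gapVec]
  rfl

instance : Finite (OrderedSetPartition (d + 1)) := by
  refine Finite.of_surjective
    (fun q : Equiv.Perm (Fin (d + 1)) × Finset (Fin d) => cut q.1 q.2) fun T => ?_
  obtain ⟨π, hπ⟩ := exists_ofPerm_le T
  obtain ⟨A, rfl⟩ := exists_eq_cut hπ
  exact ⟨(π, A), rfl⟩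

/-- The conditions on `b` are equivalent to the inequalities of the nef cone of the fan.  The
inequalities of the nef cone imply them since both sides of the relations
`e_{A ∪ B} + e_{A ∩ B} = e_A + e_B` and `2 e_T + e_S = e_{T₀} + e_{T₀'}` between rays can be compared at
one vertex, on which the two rays on the left attain their prescribed values. -/
theorem nefCone_nestedFan : (nestedFan d).nefCone = {b | LocallySubmodular b ∧ RenCondition b} := by
  ext b
  constructor
  · intro hb
    have hle : ∀ (π : Equiv.Perm (Fin (d + 1))) (τ : Equiv.Perm (Fin d)) (A : Finset (Fin d)),
        ∑ k ∈ A, greedy (cutValue b π) τ k ≤ cutValue b π A := by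
      intro π τ A
      rcases A.eq_empty_or_nonempty with rfl | hA
      · rw [Finset.sum_empty, cutValue_empty]
      · have h1 := hb (π, τ) ⟨cut π A, cut_ne_top hA⟩
        rw [cutValue_of_nonempty b hA]
        refine le_of_eq_of_le ?_ h1
        change _ = toDual d _ _
        rw [toDual_point, linearPiece]
        simp only [gap_cut_label, mul_ite, mul_one, mul_zero, Finset.sum_ite_mem, Finset.univ_inter]
    refine ⟨locallySubmodular_iff.2 fun π A B => ?_, renCondition_iff.2 fun π i => ?_⟩
    · obtain ⟨τ, hU, hI⟩ := exists_perm_upper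
        (Finset.inter_subset_left.trans Finset.subset_union_left : A ∩ B ⊆ A ∪ B)
      rw [← sum_greedy_of_upper (cutValue_empty b) hU, ← sum_greedy_of_upper (cutValue_empty b) hI,
        add_comm, Finset.sum_union_inter]
      exact add_le_add (hle _ _ _) (hle _ _ _)
    · have hsub : neighbors i ⊆ Finset.univ.erase i := fun k hk => by
        refine Finset.mem_erase.2 ⟨?_, Finset.mem_univ _⟩
        rintro rfl
        exact notMem_neighbors hk
      obtain ⟨τ, hT, hS⟩ := exists_perm_upper hsub
      have hne : (Finset.univ : Finset (Fin d)).Nonempty := ⟨i, Finset.mem_univ i⟩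
      have h1 := hb (π, τ) ⟨cut (swapAt π i) Finset.univ, cut_ne_top hne⟩
      rw [cutValue_of_nonempty (π := swapAt π i) b hne]
      have h2 : (nestedFan d).ray ⟨cut (swapAt π i) Finset.univ, cut_ne_top hne⟩
          ((nestedFan d).point b (π, τ)) = 2 * cutValue b π (Finset.univ.erase i) +
            cutValue b π (neighbors i) - cutValue b π Finset.univ := by
        change toDual d _ _ = _
        have hgap : ∀ k, gap π (fun a => ((cut (swapAt π i) Finset.univ).label a : ℝ) + 1) k =
            if k = i then -1 else 1 + if k ∈ neighbors i then 1 else 0 := by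
          intro k
          have h := gap_swapAt (π := swapAt π i) (i := i)
            (x := fun a => ((cut (swapAt π i) Finset.univ).label a : ℝ) + 1) k
          rw [swapAt_swapAt, gap_cut_label, gap_cut_label] at h
          rw [h]
          simp
        have huniv := sum_greedy_upper (τ := τ) (cutValue_empty (π := π) b) (Nat.zero_le d)
        rw [upper_zero, ← Finset.add_sum_erase _ _ (Finset.mem_univ i)] at huniv
        rw [toDual_point, linearPiece, ← Finset.add_sum_erase _ _ (Finset.mem_univ i), hgap,
          if_pos rfl, ← sum_greedy_of_upper (cutValue_empty b) hT,
          ← sum_greedy_of_upper (cutValue_empty b) hS, ← huniv]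
        have hrest : ∑ k ∈ Finset.univ.erase i, greedy (cutValue b π) τ k *
            gap π (fun a => ((cut (swapAt π i) Finset.univ).label a : ℝ) + 1) k =
            ∑ k ∈ Finset.univ.erase i, greedy (cutValue b π) τ k +
              ∑ k ∈ neighbors i, greedy (cutValue b π) τ k := by
          have hfilter : neighbors i = (Finset.univ.erase i).filter (· ∈ neighbors i) := by
            ext k
            simp only [Finset.mem_filter]
            exact ⟨fun h => ⟨hsub h, h⟩, fun h => h.2⟩
          conv_rhs => rw [hfilter, Finset.sum_filter, ← Finset.sum_add_distrib]
          refine Finset.sum_congr rfl fun k hk => ?_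
          rw [hgap, if_neg (Finset.mem_erase.1 hk).1]
          split_ifs <;> ring
        rw [hrest]
        ring
      rw [h2] at h1
      linarith
  · rintro ⟨hsub, hren⟩ ⟨π, τ⟩ T
    obtain ⟨⟨π', τ'⟩, j, rfl⟩ := (nestedFan d).exists_gen T
    rw [← (nestedFan d).ray_gen_point b (π', τ') j]
    have hmem := (nestedFan d).ray_gen_mem (π', τ') j
    change toDual d _ ∈ _ at hmem
    rw [toDual_mem_cone_iff] at hmem
    change toDual d _ _ ≤ toDual d _ _
    rw [toDual_point, toDual_point]
    exact linearPiece_le_linearPiece hsub hren hmem.1 hmem.2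

end NestedFan

/-! ### Nested permutohedra -/

section Permutohedron

variable {d : ℕ} {α : Fin (d + 1) → ℝ} {β : Fin d → ℝ} {M N : ℝ}
  {π π' : Equiv.Perm (Fin (d + 1))} {τ τ' : Equiv.Perm (Fin d)} {x : Fin (d + 1) → ℝ}

/-- The coefficients of a vertex of the nested permutohedron, in the order given by `π`, depend
on `τ` only. -/
theorem nestedPoint_symm_apply (p : Fin (d + 1)) : nestedPoint α β M N π τ (π.symm p) =
    nestedPoint α β M N (Equiv.refl _) τ p := by
  simp [nestedPoint, Pi.single_apply]

theorem sum_mul_nestedPoint : ∑ a, x a * nestedPoint α β M N π τ a =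
    ∑ p, x (π.symm p) * nestedPoint α β M N (Equiv.refl _) τ p := by
  rw [← Equiv.sum_comp π.symm]
  simp only [nestedPoint_symm_apply]

theorem sum_mul_nestedPoint' : ∑ a, x a * nestedPoint α β M N π τ a =
    M * ∑ p, α p * x (π.symm p) + N * ∑ j, gap π x (τ.symm j) * β j := by
  have hs : ∀ q : Fin (d + 1), ∑ a, x a * (Pi.single q 1 : Fin (d + 1) → ℝ) a = x q := by
    intro q
    simp [Pi.single_apply]
  simp only [nestedPoint, Pi.add_apply, Pi.smul_apply, Finset.sum_apply, smul_eq_mul, Pi.sub_apply,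
    mul_add, Finset.sum_add_distrib]
  congr 1
  · simp only [Finset.mul_sum]
    rw [Finset.sum_comm]
    refine Finset.sum_congr rfl fun p _ => ?_
    rw [← hs (π.symm p), Finset.mul_sum, Finset.mul_sum]
    exact Finset.sum_congr rfl fun a _ => by ring
  · simp only [Finset.mul_sum]
    rw [Finset.sum_comm]
    refine Finset.sum_congr rfl fun j _ => ?_
    rw [gap, ← hs (π.symm (τ.symm j).succ), ← hs (π.symm (τ.symm j).castSucc),
      ← Finset.sum_sub_distrib, Finset.sum_mul, Finset.mul_sum]
    exact Finset.sum_congr rfl fun a _ => by ring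

theorem sum_nestedPoint : ∑ a, nestedPoint α β M N π τ a = M * ∑ p, α p := by
  have h := sum_mul_nestedPoint' (α := α) (β := β) (M := M) (N := N) (π := π) (τ := τ)
    (x := fun _ => 1)
  simpa [gap] using h

/-- For `x` in the cone `σ(π, τ)`, the maximum of the linear form `x` over the points
`nestedPoint` is attained at `(π, τ)`, and the maximum is attained only at those points whose cone
contains `x`.  Both facts follow by applying the rearrangement inequality twice. -/
theorem sum_mul_nestedPoint_le (hβ : StrictMono β) (hMN : IsAppropriate α β M N)
    (hπ : Monotone fun p => x (π.symm p)) (hτ : Monotone fun j => gap π x (τ.symm j)) :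
    ∑ a, x a * nestedPoint α β M N π' τ' a ≤ ∑ a, x a * nestedPoint α β M N π τ a ∧
      (∑ a, x a * nestedPoint α β M N π' τ' a = ∑ a, x a * nestedPoint α β M N π τ a →
        (Monotone fun p => x (π'.symm p)) ∧ Monotone fun j => gap π' x (τ'.symm j)) := by
  obtain ⟨-, hN, hmono⟩ := hMN
  have hcoef : StrictMono fun p => nestedPoint α β M N (Equiv.refl _) τ' p :=
    hmono (Equiv.refl _) τ'
  have monotone_of_monovary : ∀ {n : ℕ} {f g : Fin n → ℝ}, StrictMono g → Monovary f g →
      Monotone f := by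
    intro n f g hg h i j hij
    rcases hij.eq_or_lt with rfl | hij
    · exact le_rfl
    · exact h (hg hij)
  -- First the order of the coordinates is changed from `π'` to `π`,
  have hvary₁ : Monovary (fun p => x (π.symm p))
      (fun p => nestedPoint α β M N (Equiv.refl _) τ' p) := hπ.monovary hcoef.monotone
  have hle₁ := hvary₁.sum_comp_perm_mul_le_sum_mul (σ := π'.symm.trans π)
  have heq₁ := hvary₁.sum_comp_perm_mul_eq_sum_mul_iff (σ := π'.symm.trans π)
  simp only [Equiv.trans_apply, Equiv.symm_apply_apply] at hle₁ heq₁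
  rw [← sum_mul_nestedPoint, ← sum_mul_nestedPoint] at hle₁ heq₁
  -- and then the order of the gaps from `τ'` to `τ`.
  have hvary₂ : Monovary (fun j => gap π x (τ.symm j)) β := hτ.monovary hβ.monotone
  have hle₂ := hvary₂.sum_comp_perm_mul_le_sum_mul (σ := τ'.symm.trans τ)
  have heq₂ := hvary₂.sum_comp_perm_mul_eq_sum_mul_iff (σ := τ'.symm.trans τ)
  simp only [Equiv.trans_apply, Equiv.symm_apply_apply] at hle₂ heq₂
  have hle₂' : ∑ a, x a * nestedPoint α β M N π τ' a ≤ ∑ a, x a * nestedPoint α β M N π τ a := by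
    rw [sum_mul_nestedPoint', sum_mul_nestedPoint']
    have := mul_le_mul_of_nonneg_left hle₂ hN.le
    linarith
  refine ⟨hle₁.trans hle₂', fun heq => ?_⟩
  have h₁ := heq₁.1 (le_antisymm hle₁ (heq ▸ hle₂'))
  have hmono' : Monotone fun p => x (π'.symm p) := by
    simpa [Function.comp_def] using monotone_of_monovary hcoef h₁
  have h₂ : ∑ a, x a * nestedPoint α β M N π τ' a = ∑ a, x a * nestedPoint α β M N π τ a :=
    le_antisymm hle₂' (heq ▸ hle₁)
  rw [sum_mul_nestedPoint', sum_mul_nestedPoint'] at h₂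
  have h₃ := monotone_of_monovary hβ (heq₂.1 (mul_left_cancel₀ hN.ne' (by linarith)))
  have hsame : x ∘ π'.symm = x ∘ π.symm := Tuple.unique_monotone hmono' hπ
  have hgap : gap π' x = gap π x := by
    ext k
    have h4 := congrFun hsame k.succ
    have h5 := congrFun hsame k.castSucc
    simp only [Function.comp_apply] at h4 h5
    rw [gap, gap, h4, h5]
  refine ⟨hmono', ?_⟩
  rw [hgap]
  simpa [Function.comp_def] using h₃

/-- The projection of `ℝ^{d+1}` onto the hyperplane `V_d` along `(1, …, 1)`. -/
noncomputable def center (d : ℕ) : (Fin (d + 1) → ℝ) →ₗ[ℝ] hyperplane d where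
  toFun x := ⟨fun i => x i - (∑ j, x j) / (d + 1), by
    change ∑ i, _ = _
    rw [Finset.sum_sub_distrib]
    simp only [Finset.sum_const, Finset.card_univ, Fintype.card_fin, nsmul_eq_mul]
    push_cast
    have : (d : ℝ) + 1 ≠ 0 := by positivity
    field_simp
    ring⟩
  map_add' x y := by
    ext i
    simp only [Pi.add_apply, Finset.sum_add_distrib, Submodule.coe_add]
    ring
  map_smul' c x := by
    ext i
    simp only [Pi.smul_apply, smul_eq_mul, ← Finset.mul_sum, Submodule.coe_smul, RingHom.id_apply]
    ring

theorem toDual_center (x y : Fin (d + 1) → ℝ) :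
    toDual d x (center d y) = ∑ i, x i * y i - (∑ i, x i) * ((∑ j, y j) / (d + 1)) := by
  rw [toDual_apply, Finset.sum_mul, ← Finset.sum_sub_distrib]
  exact Finset.sum_congr rfl fun i _ => mul_sub _ _ _

theorem centralize_nestedPermutohedron : centralize (nestedPermutohedron α β M N) =
    convexHull ℝ (Set.range fun σ : Equiv.Perm (Fin (d + 1)) × Equiv.Perm (Fin d) =>
      center d (nestedPoint α β M N σ.1 σ.2)) := by
  have h1 : ∀ P : Set (Fin (d + 1) → ℝ), centralize P = center d '' P := by
    intro P
    ext y
    simp only [centralize, Set.mem_ofPred_eq, Set.mem_image]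
    refine exists_congr fun x => and_congr_right fun _ => ?_
    rw [Subtype.ext_iff, eq_comm]
    rfl
  rw [h1, nestedPermutohedron, LinearMap.image_convexHull]
  congr 1
  ext y
  simp [eq_comm]

/-- The centralized nested permutohedron is a polytope whose vertices correspond to the maximal
cones of the nested Braid fan. -/
theorem isVertexSystem_nestedPermutohedron (hβ : StrictMono β) (hMN : IsAppropriate α β M N) :
    IsPolytope (centralize (nestedPermutohedron α β M N)) ∧
      (nestedFan d).IsVertexSystem (centralize (nestedPermutohedron α β M N))
        fun σ => center d (nestedPoint α β M N σ.1 σ.2) := by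
  rw [centralize_nestedPermutohedron]
  apply CompleteSimplicialFan.isVertexSystem_convexHull
  · rintro ⟨π, τ⟩ ⟨π', τ'⟩ w hw
    obtain ⟨x, rfl⟩ := toDual_surjective d w
    rw [toDual_mem_cone_iff] at hw
    have h := (sum_mul_nestedPoint_le (π' := π') (τ' := τ') hβ hMN hw.1 hw.2).1
    simp only [toDual_center, sum_nestedPoint]
    linarith
  · rintro ⟨π, τ⟩ ⟨π', τ'⟩ w hw heq
    obtain ⟨x, rfl⟩ := toDual_surjective d w
    rw [toDual_mem_cone_iff] at hw ⊢
    simp only [toDual_center, sum_nestedPoint, sub_left_inj] at heq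
    exact (sum_mul_nestedPoint_le (π' := π') (τ' := τ') hβ hMN hw.1 hw.2).2 heq

theorem strictMono_regularSeq (n : ℕ) : StrictMono (regularSeq n) := fun i j hij => by
  have : ((i : ℕ) : ℝ) < (j : ℕ) := by exact_mod_cast hij
  simpa [regularSeq] using this

theorem exists_isAppropriate (d : ℕ) :
    ∃ M N : ℝ, IsAppropriate (regularSeq (d + 1)) (regularSeq d) M N := by
  -- `N = 1`, and `M` dominates the finitely many coefficients that come from the second sum.
  obtain ⟨C, hC⟩ := (Set.finite_range fun q : Equiv.Perm (Fin d) × Fin (d + 1) =>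
    |nestedPoint (regularSeq (d + 1)) (regularSeq d) 0 1 (Equiv.refl _) q.1 q.2|).bddAbove
  have hC' : ∀ τ p, |nestedPoint (regularSeq (d + 1)) (regularSeq d) 0 1 (Equiv.refl _) τ p| ≤ C :=
    fun τ p => hC ⟨(τ, p), rfl⟩
  have hC0 : 0 ≤ C := (abs_nonneg _).trans (hC' 1 0)
  refine ⟨2 * C + 1, 1, by linarith, one_pos, fun π τ p q hpq => ?_⟩
  have hsplit : ∀ r, nestedPoint (regularSeq (d + 1)) (regularSeq d) (2 * C + 1) 1
      (Equiv.refl _) τ r = (2 * C + 1) * ((r : ℕ) + 1) +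
        nestedPoint (regularSeq (d + 1)) (regularSeq d) 0 1 (Equiv.refl _) τ r := by
    intro r
    simp [nestedPoint, regularSeq, Pi.single_apply]
  simp only [nestedPoint_symm_apply, hsplit]
  have h1 := abs_le.1 (hC' τ p)
  have h2 := abs_le.1 (hC' τ q)
  have h3 : ((p : ℕ) : ℝ) + 1 ≤ (q : ℕ) := by exact_mod_cast hpq
  nlinarith

end Permutohedron

end NestedBraid

theorem theorem4p16 (d : ℕ) :
    IsDeformationConeOfFan (nestedBraidFan d) (rayVector d)
        {b | LocallySubmodular b ∧ RenCondition b} ∧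
      (∀ M N : ℝ, IsAppropriate (regularSeq (d + 1)) (regularSeq d) M N →
        deformationCone
            (centralize (nestedPermutohedron (regularSeq (d + 1)) (regularSeq d) M N))
            (rayVector d) =
          {b | LocallySubmodular b ∧ RenCondition b}) ∧
      ∀ b : ProperOSP d → ℝ, LocallySubmodular b ↔ DiamondSubmodular b := by
  refine ⟨⟨?_, fun P₀ hP₀ hfan => ?_⟩, fun M N hMN => ?_,
    fun b => locallySubmodular_iff_diamondSubmodular⟩
  · obtain ⟨M, N, hMN⟩ := exists_isAppropriate d
    obtain ⟨hP, hv⟩ := isVertexSystem_nestedPermutohedron (strictMono_regularSeq d) hMN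
    exact ⟨_, hP, hv.normalFan_eq.trans nestedBraidFan_eq.symm⟩
  · obtain ⟨v, hv⟩ := CompleteSimplicialFan.exists_isVertexSystem (hfan.trans nestedBraidFan_eq)
    exact (hv.deformationCone_eq hP₀).trans nefCone_nestedFan
  · obtain ⟨hP, hv⟩ := isVertexSystem_nestedPermutohedron (strictMono_regularSeq d) hMN
    exact (hv.deformationCone_eq hP).trans nefCone_nestedFan
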